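/- **Setting.** Let $\mathbb N=\{1,2,\dots\}$. For each $n$ let $d^{(n)}_1,\dots,d^{(n)}_n$ be positive integers with even sum, and let $n_k$ be the number of $i\le n$ with $d^{(n)}_i=k$. Assume that there is a probability distribution $\boldsymbol p=(p_k)_{k\in\mathbb N}$ on $\mathbb N$ with $n_k/n\to p_k$ as $n\to\infty$ for every $k\in\mathbb N$, and that $\sup_n\sum_{k\ge1}\frac{n_k}{n}k^2<\infty$. Put $\mu=\sum_{k\ge1}kp_k$ and fix $T\ge\mu/2$. **Rate function.** For $\boldsymbol x=(x_0,x_1,\dots)$ let $r(\boldsymbol x)=x_0^++\sum_{k\ge1}kx_k$, $r_0(\boldsymbol x)=\frac{x_0^+}{r(\boldsymbol x)}1_{\{r(\boldsymbol x)>0\}}$ and $r_k(\boldsymbol x)=\frac{kx_k}{r(\boldsymbol x)}1_{\{r(\boldsymbol x)>0\}}$ for $k\ge1$. Let $\mathcal D_\infty$ and $\mathcal D$ be the sets of right-continuous functions with left limits from $[0,T]$ to $\mathbb R^\infty$ (with the product topology) and to $\mathbb R$, respectively. Let $\mathcal C_T$ be the set of pairs $(\boldsymbol\zeta,\psi)$,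 $\boldsymbol\zeta=(\zeta_k)_{k\ge0}$, of continuous functions in $\mathcal D_\infty\times\mathcal D$ such that $\psi(0)=0$ and $\psi$ is absolutely continuous; $\zeta_0(t)=\psi(t)-\min\{\inf_{0\le s\le t}\psi(s),0\}$ for $t\in[0,T]$; and, for every $k\ge1$, $\zeta_k(0)=p_k$ and $\zeta_k$ is non-increasing, absolutely continuous and non-negative. Let $\ell(x)=x\log x-x+1$ for $x\ge0$ (with $0\log 0=0$). For $(\boldsymbol\zeta,\psi)\in\mathcal C_T$ let $$I_T(\boldsymbol\zeta,\psi)=\inf_{\boldsymbol\varphi}\sum_{k=0}^\infty\int_{[0,T]\times[0,1]}\ell(\varphi_k(s,y))\,ds\,dy,$$ where the infimum is over all sequences of measurable functions $\varphi_k:[0,T]\times[0,1]\to[0,\infty)$, $k\ge0$, such that for all $t\in[0,T]$ $$\psi(t)=\sum_{k=0}^\infty(k-2)\int_{[0,t]\times[0,1]}1_{[0,r_k(\boldsymbol\zeta(s)))}(y)\varphi_k(s,y)\,ds\,dy,$$ $$\zeta_k(t)=p_k-\int_{[0,t]\times[0,1]}1_{[0,r_k(\boldsymbol\zeta(s)))}(y)\varphi_k(s,y)\,ds\,dy\quad(k\ge1),$$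 with all these integrals finite, and $\inf\emptyset=\infty$. For $(\boldsymbol\zeta,\psi)\in(\mathcal D_\infty\times\mathcal D)\setminus\mathcal C_T$ let $I_T(\boldsymbol\zeta,\psi)=\infty$. **The pair $(\boldsymbol\zeta,\psi)$.** For $z\in[0,1]$ let $G_0(z)=\sum_{k\ge1}p_kz^k$ and $G_1(z)=\sum_{k\ge1}\frac{kp_k}{\mu}z^{k-1}$. For $s\in(0,1]$ let $F_s(t)=G_0(s)-G_0(st)$, $t\in[0,1]$, and let $f_s(t)=F_s^{-1}(t)$ for $0\le t\le G_0(s)$ and $f_s(t)=0$ for $t>G_0(s)$; let $f_0\equiv0$. 1. If $\sum_kk(k-2)p_k\le0$, let $\zeta_0(t)=0$ and $\zeta_k(t)=p_kf_1(t)^k$ for $k\ge1$. 2. If $\sum_kk(k-2)p_k>0$, let $\rho$ be the fixed point of $G_1$ in $(0,1)$ if $p_1>0$, and $\rho=0$ if $p_1=0$. Let $\tau=\frac\mu2(1-\rho^2)$, $$\zeta_0(t)=\Big[\mu-2t-\mu\sqrt{1-2t/\mu}\;G_1\big(\sqrt{1-2t/\mu}\big)\Big]1_{[0,\tau]}(t),$$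 and, for $k\ge1$, $\zeta_k(t)=p_k(1-2t/\mu)^{k/2}$ for $0\le t\le\tau$ and $\zeta_k(t)=p_k\rho^kf_\rho(t-\tau)^k$ for $t>\tau$. In both cases let $\psi(t)=-2\int_0^tr_0(\boldsymbol\zeta(s))\,ds+\sum_{k\ge1}(k-2)(p_k-\zeta_k(t))$. **Proposition.** In case 2, $\rho$ exists and is unique, and $G_1(\rho)=\rho$ also when $p_1=0$. In both cases the pair $(\boldsymbol\zeta,\psi)$ just defined, restricted to $[0,T]$, belongs to $\mathcal D_\infty\times\mathcal D$, satisfies $I_T(\boldsymbol\zeta,\psi)=0$, and is the unique element of $\mathcal D_\infty\times\mathcal D$ at which $I_T$ vanishes. -/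

import Mathlib

open Set Filter Topology MeasureTheory
open scoped ENNReal NNReal

namespace ConfigModel

noncomputable section

/-! ### Degree sequences and the standing assumptions -/

/-- `degCount d n k` is the number of vertices of degree `k` in the `n`-th degree sequence. -/
def degCount (d : (n : ℕ) → Fin n → ℕ) (n k : ℕ) : ℕ :=
  (Finset.univ.filter fun i : Fin n => d n i = k).card

/-- Each `d n` is a degree sequence on `n` vertices: all degrees are positive and the total
degree is even. -/
def IsDegreeSequence (d : (n : ℕ) → Fin n → ℕ) : Prop :=
  ∀ n, (∀ i, 0 < d n i) ∧ Even (∑ i, d n i)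

/-- `p` is a probability distribution on `{1, 2, …}` (so `p 0 = 0`) and the proportion of vertices
of degree `k` converges to `p k` for every `k ≥ 1`. -/
def DegreeLimit (d : (n : ℕ) → Fin n → ℕ) (p : ℕ → ℝ) : Prop :=
  ((∀ k, 0 ≤ p k) ∧ p 0 = 0 ∧ HasSum p 1) ∧
    ∀ k, 1 ≤ k → Tendsto (fun n : ℕ => (degCount d n k : ℝ) / n) atTop (𝓝 (p k))

/-- The second moments `∑ₖ (nₖ / n) k²` are bounded uniformly in `n`.  (For fixed `n` only finitely
many terms are non-zero.) -/
def SecondMomentBounded (d : (n : ℕ) → Fin n → ℕ) : Prop :=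
  BddAbove (range fun n : ℕ => ∑' k : ℕ, (degCount d n k : ℝ) / n * (k : ℝ) ^ 2)

/-! ### Paths on `[0, T]` -/

/-- A path on `[0, T]` is càdlàg if it is right continuous with left limits. -/
def IsCadlag {T : ℝ} {E : Type*} [TopologicalSpace E] (f : Icc (0 : ℝ) T → E) : Prop :=
  ∀ t, ContinuousWithinAt f (Ici t) t ∧ ∃ l, Tendsto f (𝓝[<] t) (𝓝 l)

/-- The set `𝔻([0, T] : E)` of càdlàg paths.  (Its Skorokhod topology plays no role here.) -/
def CadlagPath (T : ℝ) (E : Type*) [TopologicalSpace E] : Type _ :=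
  {f : Icc (0 : ℝ) T → E // IsCadlag f}

/-- The path as a function on `ℝ`, with value `0` outside `[0, T]`; it is only ever evaluated
at points of `[0, T]`. -/
def extendPath {T : ℝ} {E : Type*} [Zero E] (f : Icc (0 : ℝ) T → E) (t : ℝ) : E :=
  open scoped Classical in if h : t ∈ Icc (0 : ℝ) T then f ⟨t, h⟩ else 0

/-! ### The rates -/

/-- `r(x) = x₀⁺ + ∑_{k ≥ 1} k xₖ`. -/
def totalRate (x : ℕ → ℝ) : ℝ := max (x 0) 0 + ∑' k : ℕ, (k : ℝ) * x k

/-- `r₀(x) = x₀⁺ / r(x)` and `rₖ(x) = k xₖ / r(x)` for `k ≥ 1`, and `0` unless `r(x) > 0`. -/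
def rate (k : ℕ) (x : ℕ → ℝ) : ℝ :=
  if 0 < totalRate x then (if k = 0 then max (x 0) 0 else (k : ℝ) * x k) / totalRate x else 0

/-! ### The rate function -/

/-- The one-dimensional Skorokhod map `Γ(ψ)(t) = ψ(t) - (inf_{0 ≤ s ≤ t} ψ(s)) ∧ 0`. -/
def skorokhodMap {T : ℝ} (ψ : Icc (0 : ℝ) T → ℝ) (t : Icc (0 : ℝ) T) : ℝ :=
  ψ t - min (sInf (ψ '' Iic t)) 0

/-- The set `𝒞_T` of admissible pairs of paths. -/
def Admissible (p : ℕ → ℝ) {T : ℝ} (ζ : Icc (0 : ℝ) T → ℕ → ℝ) (ψ : Icc (0 : ℝ) T → ℝ) : Prop :=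
  Continuous ζ ∧ Continuous ψ ∧
  (extendPath ψ 0 = 0 ∧ AbsolutelyContinuousOnInterval (extendPath ψ) 0 T) ∧
  (∀ t, ζ t 0 = skorokhodMap ψ t) ∧
  ∀ k, 1 ≤ k → extendPath ζ 0 k = p k ∧ Antitone (fun t => ζ t k) ∧
    AbsolutelyContinuousOnInterval (fun t => extendPath ζ t k) 0 T ∧ ∀ t, 0 ≤ ζ t k

/-- The thinned intensity `1_{[0, rₖ(ζ(s)))}(y) φₖ(s, y)` at the point `(s, y)`. -/
def thinned {T : ℝ} (ζ : Icc (0 : ℝ) T → ℕ → ℝ) (φ : ℕ → ℝ × ℝ → ℝ≥0) (k : ℕ) (x : ℝ × ℝ) : ℝ :=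
  (Ico 0 (rate k (extendPath ζ x.1))).indicator (fun _ => (φ k x : ℝ)) x.2

/-- `∫_{[0,t] × [0,1]} 1_{[0, rₖ(ζ(s)))}(y) φₖ(s, y) ds dy`. -/
def flux {T : ℝ} (ζ : Icc (0 : ℝ) T → ℕ → ℝ) (φ : ℕ → ℝ × ℝ → ℝ≥0) (k : ℕ) (t : ℝ) : ℝ :=
  ∫ x in Icc (0 : ℝ) t ×ˢ Icc (0 : ℝ) 1, thinned ζ φ k x

/-- The set `𝒮_T(ζ, ψ)` of intensities `φ` that produce `(ζ, ψ)`.  Only the values of `φ` on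
`[0, T] × [0, 1]` matter; the integrability clause says that the integrals in the two equations
are finite. -/
def intensities (p : ℕ → ℝ) {T : ℝ} (ζ : Icc (0 : ℝ) T → ℕ → ℝ) (ψ : Icc (0 : ℝ) T → ℝ) :
    Set (ℕ → ℝ × ℝ → ℝ≥0) :=
  {φ | (∀ k, Measurable (φ k)) ∧
    (∀ k, IntegrableOn (thinned ζ φ k) (Icc (0 : ℝ) T ×ˢ Icc (0 : ℝ) 1)) ∧
    ∀ t : Icc (0 : ℝ) T,
      HasSum (fun k : ℕ => ((k : ℝ) - 2) * flux ζ φ k t) (ψ t) ∧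
      ∀ k, 1 ≤ k → ζ t k = p k - flux ζ φ k t}

/-- `ℓ(x) = x log x - x + 1`. -/
def ell (x : ℝ) : ℝ := x * Real.log x - x + 1

/-- `∑ₖ ∫_{[0,T] × [0,1]} ℓ(φₖ(s, y)) ds dy`. -/
def cost (T : ℝ) (φ : ℕ → ℝ × ℝ → ℝ≥0) : ℝ≥0∞ :=
  ∑' k : ℕ, ∫⁻ x in Icc (0 : ℝ) T ×ˢ Icc (0 : ℝ) 1, ENNReal.ofReal (ell (φ k x))

/-- The rate function `I_T` on `𝔻([0, T] : ℝ^∞) × 𝔻([0, T] : ℝ)`. -/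
def rateFunction (p : ℕ → ℝ) (T : ℝ) (x : CadlagPath T (ℕ → ℝ) × CadlagPath T ℝ) : ℝ≥0∞ :=
  open scoped Classical in
  if Admissible p x.1.1 x.2.1 then ⨅ φ ∈ intensities p x.1.1 x.2.1, cost T φ else ⊤

/-! ### The explicit pair -/

/-- `μ = ∑ₖ k pₖ`. -/
def mean (p : ℕ → ℝ) : ℝ := ∑' k : ℕ, (k : ℝ) * p k

/-- `∑ₖ k (k - 2) pₖ`, whose sign distinguishes the two cases. -/
def criticality (p : ℕ → ℝ) : ℝ := ∑' k : ℕ, (k : ℝ) * ((k : ℝ) - 2) * p k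

/-- `G₀(z) = ∑_{k ≥ 1} pₖ z^k`  (recall `p 0 = 0`). -/
def G₀ (p : ℕ → ℝ) (z : ℝ) : ℝ := ∑' k : ℕ, p k * z ^ k

/-- `G₁(z) = ∑_{k ≥ 1} (k pₖ / μ) z^(k - 1)`  (the term `k = 0` vanishes). -/
def G₁ (p : ℕ → ℝ) (z : ℝ) : ℝ := ∑' k : ℕ, (k : ℝ) * p k / mean p * z ^ (k - 1)

/-- `F_s(t) = G₀(s) - G₀(s t)`. -/
def F (p : ℕ → ℝ) (s t : ℝ) : ℝ := G₀ p s - G₀ p (s * t)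

/-- For `s > 0` and `t ≥ 0`, `f_s(t)` is the inverse of `F_s : [0, 1] → [0, G₀(s)]` at `t` if
`t ≤ G₀(s)`, and `0` if `t > G₀(s)`; moreover `f_0 = 0`. -/
def fInv (p : ℕ → ℝ) (s t : ℝ) : ℝ :=
  if s = 0 then 0 else if t ≤ G₀ p s then Function.invFunOn (F p s) (Icc 0 1) t else 0

/-- The path `ζ` in the case `∑ₖ k (k - 2) pₖ ≤ 0`. -/
def zetaSub (p : ℕ → ℝ) (t : ℝ) (k : ℕ) : ℝ :=
  if k = 0 then 0 else p k * fInv p 1 t ^ k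

/-- The requirement on `ρ` in the case `∑ₖ k (k - 2) pₖ > 0`: a fixed point of `G₁`, in `(0, 1)`
if `p₁ > 0` and equal to `0` if `p₁ = 0`. -/
def IsRoot (p : ℕ → ℝ) (ρ : ℝ) : Prop :=
  ((0 < p 1 ∧ ρ ∈ Ioo (0 : ℝ) 1) ∨ (p 1 = 0 ∧ ρ = 0)) ∧ G₁ p ρ = ρ

/-- `τ = (μ / 2) (1 - ρ²)`. -/
def tau (p : ℕ → ℝ) (ρ : ℝ) : ℝ := mean p / 2 * (1 - ρ ^ 2)

/-- The path `ζ` in the case `∑ₖ k (k - 2) pₖ > 0`. -/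
def zetaSup (p : ℕ → ℝ) (ρ : ℝ) (t : ℝ) (k : ℕ) : ℝ :=
  if k = 0 then
    if t ≤ tau p ρ then
      mean p - 2 * t - mean p * √(1 - 2 * t / mean p) * G₁ p (√(1 - 2 * t / mean p))
    else 0
  else
    if t ≤ tau p ρ then p k * (1 - 2 * t / mean p) ^ ((k : ℝ) / 2)
    else p k * ρ ^ k * fInv p ρ (t - tau p ρ) ^ k

/-- `ψ(t) = -2 ∫₀ᵗ r₀(ζ(s)) ds + ∑_{k ≥ 1} (k - 2) (pₖ - ζₖ(t))`. -/
def psiOf (p : ℕ → ℝ) (ζ : ℝ → ℕ → ℝ) (t : ℝ) : ℝ :=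
  -2 * (∫ s in (0 : ℝ)..t, rate 0 (ζ s)) +
    ∑' k : ℕ, if k = 0 then 0 else ((k : ℝ) - 2) * (p k - ζ t k)

/-- On `[0, T]`, the pair `(ζ, ψ)` with `ψ` given by `psiOf` is a pair of càdlàg paths, `I_T`
vanishes at it, and it is the only pair of càdlàg paths where `I_T` vanishes. -/
def IsUniqueZero (p : ℕ → ℝ) (T : ℝ) (ζ : ℝ → ℕ → ℝ) : Prop :=
  ∃ x : CadlagPath T (ℕ → ℝ) × CadlagPath T ℝ,
    (∀ t : Icc (0 : ℝ) T, x.1.1 t = ζ t ∧ x.2.1 t = psiOf p ζ t) ∧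
    rateFunction p T x = 0 ∧
    ∀ y : CadlagPath T (ℕ → ℝ) × CadlagPath T ℝ, rateFunction p T y = 0 → y = x

end

end ConfigModel

open ConfigModel

namespace ConfigModel

noncomputable section

/-! Since `ell` vanishes only at 1, a zero of the rate function should be a path driven by the
intensities `φ ≡ 1`, that is, a solution of the fluid equations `ζₖ' = -rₖ(ζ)`, `ψ = ∑ (k - 2) ∫
rₖ(ζ)`, `ζ₀ = Γ(ψ)`. The infimum need not be known to be attained: `|x - 1| ≤ ε⁻¹ ell x + ε` shows
that intensities of cost at most `ε²` have fluxes within `ε (1 + T)` of those of `φ ≡ 1`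
(`isReflectedPath_of_rateFunction_eq_zero`).

The fluid equations can be solved. From `ζₖ' = -k ζₖ / r` one gets `ζₖ = pₖ zᵏ` with one function
`z`, where `z' = -z / r`. Write `M(z) = ∑ k pₖ zᵏ` (`edgeSeries`). While the process is active, `ψ =
μ - 2t - M(z)`, so `r = μ - 2t - min (inf ψ) 0`. Where `M(z) ≤ μ z²`, reflection never acts: then `r
= μ - 2t`, `z² = 1 - 2t/μ` and `ζ₀ = ψ = μ z² - M(z)`. This lasts until `z = ρ`, at time `τ`. Below
`ρ` the drift `∑ k (k - 2) pₖ z^(k-1)` is at most 0, so `ψ` decreases, `ζ₀ = 0`, and `G₀(z) = ∑ ζₖ`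
falls at unit rate until it reaches 0.

The signs on either side of `ρ` come from `μ z² - M(z) = z (1 - z) (D(z) - μ)`, where `D`
(`chordSlope`) is the monotone chord slope of `μ G₁`. The case of non-positive criticality is `ρ =
1`, `τ = 0`, so `IsThreshold` treats both cases together. Conversely, the explicit path solves `z' =
-z / r` away from two times, which gives existence. -/

/-- A probability distribution on `{1, 2, …}` with finite second moment. -/
structure FiniteSecondMoment (p : ℕ → ℝ) : Prop where
  nonneg : ∀ k, 0 ≤ p k
  zero : p 0 = 0
  hasSum : HasSum p 1
  summable_sq : Summable fun k : ℕ => (k : ℝ) ^ 2 * p k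

theorem DegreeLimit.finiteSecondMoment {d : (n : ℕ) → Fin n → ℕ} {p : ℕ → ℝ}
    (hlim : DegreeLimit d p) (hmom : SecondMomentBounded d) : FiniteSecondMoment p := by
  obtain ⟨⟨h0, hz, hs⟩, hk⟩ := hlim
  refine ⟨h0, hz, hs, ?_⟩
  obtain ⟨C, hC⟩ := hmom
  refine summable_of_sum_le (c := C) (fun k => mul_nonneg (sq_nonneg _) (h0 k)) fun u => ?_
  have hlim : Tendsto (fun n : ℕ => ∑ k ∈ u, (k : ℝ) ^ 2 * ((degCount d n k : ℝ) / n)) atTop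
      (𝓝 (∑ k ∈ u, (k : ℝ) ^ 2 * p k)) := by
    refine tendsto_finsetSum _ fun k _ => ?_
    rcases Nat.eq_zero_or_pos k with rfl | hk'
    · simp
    · exact (hk k hk').const_mul _
  refine le_of_tendsto' hlim fun n => ?_
  refine le_trans ?_ (hC ⟨n, rfl⟩)
  -- Only finitely many degrees occur for fixed `n`. Without summability `∑'` would be 0 by
  -- convention and would not dominate the partial sums.
  have : Summable fun k : ℕ => (degCount d n k : ℝ) / n * (k : ℝ) ^ 2 := by
    refine summable_of_ne_finset_zero (s := Finset.univ.image (d n)) fun k hk => ?_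
    have : degCount d n k = 0 := by
      simp only [degCount, Finset.card_eq_zero, Finset.filter_eq_empty_iff]
      intro i _ hi
      exact hk (Finset.mem_image.2 ⟨i, Finset.mem_univ _, hi⟩)
    simp [this]
  refine le_trans (le_of_eq ?_) (this.sum_le_tsum u fun k _ => by positivity)
  exact Finset.sum_congr rfl fun k _ => mul_comm _ _

/-! ### Power series of the degree distribution. -/

/-- `∑ₖ k pₖ zᵏ`. -/
def edgeSeries (p : ℕ → ℝ) (z : ℝ) : ℝ := ∑' k : ℕ, (k : ℝ) * p k * z ^ k

theorem edgeSeries_one (p : ℕ → ℝ) : edgeSeries p 1 = mean p := by simp [edgeSeries, mean]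

/-- `∑ₖ k (k - 2) pₖ z^(k-1)`. -/
def driftSeries (p : ℕ → ℝ) (z : ℝ) : ℝ := ∑' k : ℕ, (k : ℝ) * ((k : ℝ) - 2) * p k * z ^ (k - 1)

/-- The slope of the chord of `μ G₁` between `z` and `1`. -/
def chordSlope (p : ℕ → ℝ) (z : ℝ) : ℝ :=
  ∑' k : ℕ, (k : ℝ) * p k * ∑ i ∈ Finset.range (k - 1), z ^ i

theorem Summable.mul_pow_of_mem_Icc {c : ℕ → ℝ} (hc : Summable c) (h0 : ∀ k, 0 ≤ c k)
    (e : ℕ → ℕ) {z : ℝ} (hz : z ∈ Icc (0 : ℝ) 1) : Summable fun k => c k * z ^ e k :=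
  hc.of_nonneg_of_le (fun k => mul_nonneg (h0 k) (pow_nonneg hz.1 _)) fun k =>
    mul_le_of_le_one_right (h0 k) (pow_le_one₀ hz.1 hz.2)

theorem continuousOn_tsum_mul_pow {c : ℕ → ℝ} (hc : Summable c) (h0 : ∀ k, 0 ≤ c k)
    (e : ℕ → ℕ) : ContinuousOn (fun z : ℝ => ∑' k, c k * z ^ e k) (Icc 0 1) := by
  refine continuousOn_tsum (fun k => by fun_prop) hc fun k z hz => ?_
  rw [Real.norm_of_nonneg (mul_nonneg (h0 k) (pow_nonneg hz.1 _))]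
  exact mul_le_of_le_one_right (h0 k) (pow_le_one₀ hz.1 hz.2)

namespace FiniteSecondMoment

variable {p : ℕ → ℝ} (h : FiniteSecondMoment p)
include h

theorem mul_nonneg' (k : ℕ) : 0 ≤ (k : ℝ) * p k := mul_nonneg k.cast_nonneg (h.nonneg k)

theorem sum_eq : ∑' k, p k = 1 := h.hasSum.tsum_eq

theorem summable_mul : Summable fun k : ℕ => (k : ℝ) * p k := by
  refine h.summable_sq.of_nonneg_of_le h.mul_nonneg' fun k => ?_
  refine mul_le_mul_of_nonneg_right ?_ (h.nonneg k)
  exact_mod_cast Nat.le_self_pow two_ne_zero k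

theorem summable_drift : Summable fun k : ℕ => (k : ℝ) * ((k : ℝ) - 2) * p k :=
  (h.summable_sq.sub (h.summable_mul.mul_left 2)).congr fun k => by ring

theorem summable_pred : Summable fun k : ℕ => (k : ℝ) * ((k : ℝ) - 1) * p k :=
  (h.summable_sq.sub h.summable_mul).congr fun k => by ring

theorem pred_nonneg (k : ℕ) : 0 ≤ (k : ℝ) * ((k : ℝ) - 1) * p k := by
  rcases Nat.eq_zero_or_pos k with rfl | hk
  · simp
  · have : (1 : ℝ) ≤ k := by exact_mod_cast hk
    exact mul_nonneg (mul_nonneg k.cast_nonneg (by linarith)) (h.nonneg k)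

theorem mean_pos : 0 < mean p := by
  have : (1 : ℝ) ≤ mean p := by
    rw [← h.sum_eq]
    refine h.hasSum.summable.tsum_le_tsum (fun k => ?_) h.summable_mul
    rcases Nat.eq_zero_or_pos k with rfl | hk
    · simp [h.zero]
    · have : (1 : ℝ) ≤ k := by exact_mod_cast hk
      nlinarith [h.nonneg k]
  linarith

theorem exists_pos : ∃ k, 1 ≤ k ∧ 0 < p k := by
  by_contra! hc
  have : ∀ k, p k = 0 := fun k => by
    rcases Nat.eq_zero_or_pos k with rfl | hk
    · exact h.zero
    · exact le_antisymm (hc k hk) (h.nonneg k)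
  have h1 := h.sum_eq
  simp [this] at h1

theorem summable_G₀ {z : ℝ} (hz : z ∈ Icc (0 : ℝ) 1) : Summable fun k => p k * z ^ k :=
  Summable.mul_pow_of_mem_Icc h.hasSum.summable h.nonneg _ hz

theorem summable_edgeSeries {z : ℝ} (hz : z ∈ Icc (0 : ℝ) 1) :
    Summable fun k : ℕ => (k : ℝ) * p k * z ^ k :=
  Summable.mul_pow_of_mem_Icc h.summable_mul h.mul_nonneg' _ hz

theorem summable_edgeSeries_pred {z : ℝ} (hz : z ∈ Icc (0 : ℝ) 1) :
    Summable fun k : ℕ => (k : ℝ) * p k * z ^ (k - 1) :=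
  Summable.mul_pow_of_mem_Icc h.summable_mul h.mul_nonneg' (fun k => k - 1) hz

theorem summable_pred_mul_pow {z : ℝ} (hz : z ∈ Icc (0 : ℝ) 1) :
    Summable fun k : ℕ => (k : ℝ) * ((k : ℝ) - 1) * p k * z ^ (k - 1) :=
  Summable.mul_pow_of_mem_Icc h.summable_pred h.pred_nonneg (fun k => k - 1) hz

theorem summable_driftSeries {z : ℝ} (hz : z ∈ Icc (0 : ℝ) 1) :
    Summable fun k : ℕ => (k : ℝ) * ((k : ℝ) - 2) * p k * z ^ (k - 1) :=
  ((h.summable_pred_mul_pow hz).sub (h.summable_edgeSeries_pred hz)).congr fun k => by ring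

theorem continuousOn_G₀ : ContinuousOn (G₀ p) (Icc 0 1) :=
  continuousOn_tsum_mul_pow h.hasSum.summable h.nonneg fun k => k

theorem continuousOn_edgeSeries : ContinuousOn (edgeSeries p) (Icc 0 1) :=
  continuousOn_tsum_mul_pow h.summable_mul h.mul_nonneg' fun k => k

theorem mean_mul_G₁ (z : ℝ) : mean p * G₁ p z = ∑' k : ℕ, (k : ℝ) * p k * z ^ (k - 1) := by
  rw [G₁, ← tsum_mul_left]
  refine tsum_congr fun k => ?_
  have := h.mean_pos.ne'
  field_simp

theorem edgeSeries_eq (z : ℝ) : edgeSeries p z = mean p * z * G₁ p z := by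
  rw [mul_right_comm, h.mean_mul_G₁, ← tsum_mul_right, edgeSeries]
  refine tsum_congr fun k => ?_
  rcases Nat.eq_zero_or_pos k with rfl | hk
  · simp
  · rw [mul_assoc ((k : ℝ) * p k), pow_sub_one_mul hk.ne']

theorem edgeSeries_pos {z : ℝ} (hz : z ∈ Icc (0 : ℝ) 1) (hz0 : 0 < z) : 0 < edgeSeries p z := by
  obtain ⟨k, hk, hpk⟩ := h.exists_pos
  have hk' : (0 : ℝ) < k := by exact_mod_cast hk
  exact (h.summable_edgeSeries hz).tsum_pos
    (fun k => mul_nonneg (h.mul_nonneg' k) (pow_nonneg hz.1 _)) k (by positivity)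

theorem G₀_zero : G₀ p 0 = 0 := by
  rw [G₀, tsum_eq_single 0 fun k hk => by simp [hk]]
  simp [h.zero]

theorem G₀_one : G₀ p 1 = 1 := by simp [G₀, h.sum_eq]

theorem strictMonoOn_G₀ : StrictMonoOn (G₀ p) (Icc 0 1) := by
  intro a ha b hb hab
  obtain ⟨k, hk, hpk⟩ := h.exists_pos
  refine Summable.tsum_lt_tsum (i := k) (fun j => ?_) ?_ (h.summable_G₀ ha) (h.summable_G₀ hb)
  · exact mul_le_mul_of_nonneg_left (pow_le_pow_left₀ ha.1 hab.le _) (h.nonneg j)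
  · exact mul_lt_mul_of_pos_left (pow_lt_pow_left₀ hab ha.1 (by omega)) hpk

theorem hasDerivAt_G₀ {z : ℝ} (hz : z ∈ Ioo (0 : ℝ) 1) :
    HasDerivAt (G₀ p) (edgeSeries p z / z) z := by
  have key := hasDerivAt_tsum_of_isPreconnected (𝕜 := ℝ) (u := fun k : ℕ => (k : ℝ) * p k)
    (g := fun k z => p k * z ^ k) (g' := fun k z => p k * ((k : ℝ) * z ^ (k - 1))) (y₀ := z)
    (t := Ioo (0 : ℝ) 1) (y := z) h.summable_mul isOpen_Ioo isPreconnected_Ioo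
    (fun k y _ => (hasDerivAt_pow k y).const_mul _) (fun k y hy => ?_) hz
    (h.summable_G₀ (Ioo_subset_Icc_self hz)) hz
  · convert! key using 1
    rw [h.edgeSeries_eq, mul_right_comm, mul_div_assoc, div_self hz.1.ne', mul_one, h.mean_mul_G₁]
    exact tsum_congr fun k => by ring
  · have : 0 ≤ y ^ (k - 1) := pow_nonneg hy.1.le _
    rw [Real.norm_of_nonneg (mul_nonneg (h.nonneg k) (by positivity)), mul_left_comm, ← mul_assoc]
    exact mul_le_of_le_one_right (h.mul_nonneg' k) (pow_le_one₀ hy.1.le hy.2.le)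

theorem summable_chordSlope {z : ℝ} (hz : z ∈ Icc (0 : ℝ) 1) :
    Summable fun k : ℕ => (k : ℝ) * p k * ∑ i ∈ Finset.range (k - 1), z ^ i := by
  refine h.summable_sq.of_nonneg_of_le (fun k => mul_nonneg (h.mul_nonneg' k)
    (Finset.sum_nonneg fun i _ => pow_nonneg hz.1 _)) fun k => ?_
  have : ∑ i ∈ Finset.range (k - 1), z ^ i ≤ k := by
    refine (Finset.sum_le_card_nsmul _ _ 1 fun i _ => pow_le_one₀ hz.1 hz.2).trans ?_
    simp only [Finset.card_range, nsmul_eq_mul, mul_one]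
    exact_mod_cast Nat.sub_le k 1
  nlinarith [h.mul_nonneg' k]

theorem continuousOn_chordSlope : ContinuousOn (chordSlope p) (Icc 0 1) := by
  refine continuousOn_tsum (fun k => by fun_prop) h.summable_sq fun k z hz => ?_
  rw [Real.norm_of_nonneg (mul_nonneg (h.mul_nonneg' k)
    (Finset.sum_nonneg fun i _ => pow_nonneg hz.1 _))]
  have : ∑ i ∈ Finset.range (k - 1), z ^ i ≤ k := by
    refine (Finset.sum_le_card_nsmul _ _ 1 fun i _ => pow_le_one₀ hz.1 hz.2).trans ?_
    simp only [Finset.card_range, nsmul_eq_mul, mul_one]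
    exact_mod_cast Nat.sub_le k 1
  nlinarith [h.mul_nonneg' k]

theorem monotoneOn_chordSlope : MonotoneOn (chordSlope p) (Icc 0 1) := by
  intro a ha b hb hab
  refine (h.summable_chordSlope ha).tsum_le_tsum (fun k => ?_) (h.summable_chordSlope hb)
  exact mul_le_mul_of_nonneg_left
    (Finset.sum_le_sum fun i _ => pow_le_pow_left₀ ha.1 hab _) (h.mul_nonneg' k)

/-- Geometric sums, term by term. The series form of the slope still makes sense at `z = 1`, where
it encodes the criticality. -/
theorem mean_mul_one_sub_G₁ {z : ℝ} (hz : z ∈ Icc (0 : ℝ) 1) :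
    mean p * (1 - G₁ p z) = (1 - z) * chordSlope p z := by
  rw [mul_sub, h.mean_mul_G₁, mul_one, mean,
    ← h.summable_mul.tsum_sub (h.summable_edgeSeries_pred hz), chordSlope, ← tsum_mul_left]
  refine tsum_congr fun k => ?_
  have := mul_neg_geom_sum z (k - 1)
  rw [mul_left_comm, this]
  ring

theorem chordSlope_one : chordSlope p 1 = criticality p + mean p := by
  rw [criticality, mean, ← h.summable_drift.tsum_add h.summable_mul, chordSlope]
  refine tsum_congr fun k => ?_
  rcases Nat.eq_zero_or_pos k with rfl | hk
  · simp
  · simp only [one_pow, Finset.sum_const, Finset.card_range, nsmul_eq_mul, mul_one,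
      Nat.cast_sub hk]
    push_cast
    ring

theorem chordSlope_zero : chordSlope p 0 = mean p - p 1 := by
  have h1 : Summable fun k : ℕ => if k = 1 then p 1 else 0 :=
    (hasSum_ite_eq 1 (p 1)).summable
  have h2 : ∑' k : ℕ, (if k = 1 then p 1 else 0) = p 1 := (hasSum_ite_eq 1 (p 1)).tsum_eq
  rw [← h2, mean, ← h.summable_mul.tsum_sub h1, chordSlope]
  refine tsum_congr fun k => ?_
  rcases k with _ | _ | k
  · simp
  · simp
  · simp [Finset.sum_range_succ']

/-- Positive criticality forces mass on some `k ≥ 3`, and only for such `k` does the geometric sum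
contain the non-constant term `z ^ 1`. -/
theorem strictMonoOn_chordSlope (hc : 0 < criticality p) :
    StrictMonoOn (chordSlope p) (Icc 0 1) := by
  obtain ⟨k, hk, hpk⟩ : ∃ k, 3 ≤ k ∧ 0 < p k := by
    by_contra! hcon
    refine hc.not_ge (tsum_nonpos fun k => ?_)
    rcases le_or_gt 3 k with h3 | h3
    · rw [le_antisymm (hcon k h3) (h.nonneg k), mul_zero]
    · have : (k : ℝ) ≤ 2 := by exact_mod_cast Nat.lt_succ_iff.1 h3
      exact mul_nonpos_of_nonpos_of_nonneg
        (mul_nonpos_of_nonneg_of_nonpos k.cast_nonneg (by linarith)) (h.nonneg k)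
  intro a ha b hb hab
  refine Summable.tsum_lt_tsum (i := k) (fun j => ?_) ?_ (h.summable_chordSlope ha)
    (h.summable_chordSlope hb)
  · exact mul_le_mul_of_nonneg_left
      (Finset.sum_le_sum fun i _ => pow_le_pow_left₀ ha.1 hab.le _) (h.mul_nonneg' j)
  · have hk' : (0 : ℝ) < k := by exact_mod_cast (by omega : 0 < k)
    refine mul_lt_mul_of_pos_left (Finset.sum_lt_sum
      (fun i _ => pow_le_pow_left₀ ha.1 hab.le _) ⟨1, ?_, ?_⟩) (by positivity)
    · simp; omega
    · simpa using hab

/-- The only negative coefficient is that of `k = 1`, whose term is constant in `z`. -/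
theorem driftSeries_mono {a b : ℝ} (ha : 0 ≤ a) (hab : a ≤ b) (hb : b ≤ 1) :
    driftSeries p a ≤ driftSeries p b := by
  refine (h.summable_driftSeries ⟨ha, hab.trans hb⟩).tsum_le_tsum (fun k => ?_)
    (h.summable_driftSeries ⟨ha.trans hab, hb⟩)
  rcases k with _ | _ | k
  · simp
  · simp
  · refine mul_le_mul_of_nonneg_left (pow_le_pow_left₀ ha hab _) ?_
    refine mul_nonneg (mul_nonneg (Nat.cast_nonneg _) ?_) (h.nonneg _)
    push_cast
    linarith [(k.cast_nonneg : (0 : ℝ) ≤ k)]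

end FiniteSecondMoment

/-! ### The threshold `ρ`. -/

/-- The properties of the extinction parameter `ρ` on which the form of the zero of the rate
function depends; `ρ = 1` in the (sub)critical case. -/
structure IsThreshold (p : ℕ → ℝ) (ρ : ℝ) : Prop where
  mem : ρ ∈ Icc (0 : ℝ) 1
  edgeSeries_eq : edgeSeries p ρ = mean p * ρ ^ 2
  edgeSeries_le : ∀ z ∈ Icc ρ 1, edgeSeries p z ≤ mean p * z ^ 2
  le_edgeSeries : ∀ z ∈ Icc 0 ρ, mean p * z ^ 2 ≤ edgeSeries p z
  driftSeries_nonpos : ∀ z ∈ Icc 0 ρ, driftSeries p z ≤ 0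

namespace FiniteSecondMoment

variable {p : ℕ → ℝ} (h : FiniteSecondMoment p)
include h

/-- Reduces the comparison of `edgeSeries` with `μ z²` to that of the monotone function `chordSlope`
with `μ`. -/
theorem edgeSeries_sub {z : ℝ} (hz : z ∈ Icc (0 : ℝ) 1) :
    mean p * z ^ 2 - edgeSeries p z = z * (1 - z) * (chordSlope p z - mean p) := by
  have := h.mean_mul_one_sub_G₁ hz
  rw [h.edgeSeries_eq]
  linear_combination z * this

theorem isThreshold_one (hc : criticality p ≤ 0) : IsThreshold p 1 := by
  refine ⟨by simp, by simp [edgeSeries_one], fun z hz => ?_, fun z hz => ?_, fun z hz => ?_⟩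
  · have : z = 1 := le_antisymm hz.2 hz.1
    simp [this, edgeSeries_one]
  · have h1 := h.edgeSeries_sub hz
    have h2 := h.monotoneOn_chordSlope hz (by simp) hz.2
    rw [h.chordSlope_one] at h2
    have h3 : 0 ≤ z * (1 - z) := mul_nonneg hz.1 (by linarith [hz.2])
    nlinarith
  · refine (h.driftSeries_mono hz.1 hz.2 le_rfl).trans ?_
    simpa [driftSeries, criticality] using hc

/-- Removes the trivial fixed point 1 and merges the two alternatives on `p 1`: since `chordSlope p
0 = μ - p 1`, the solution is 0 exactly when `p 1 = 0`. -/
theorem isRoot_iff {ρ : ℝ} (hc : 0 < criticality p) :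
    IsRoot p ρ ↔ ρ ∈ Ico (0 : ℝ) 1 ∧ chordSlope p ρ = mean p := by
  have hm := h.mean_pos
  have hfix : ∀ ρ ∈ Ico (0 : ℝ) 1, (G₁ p ρ = ρ ↔ chordSlope p ρ = mean p) := by
    intro ρ hρ
    have h1 := h.mean_mul_one_sub_G₁ (Ico_subset_Icc_self hρ)
    have h2 : 0 < 1 - ρ := by linarith [hρ.2]
    constructor
    · intro h3
      rw [h3, mul_comm] at h1
      exact (mul_left_cancel₀ h2.ne' h1).symm
    · intro h3
      rw [h3, mul_comm] at h1
      linarith [mul_right_cancel₀ hm.ne' h1]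
  have hinj := (h.strictMonoOn_chordSlope hc).injOn
  constructor
  · rintro ⟨⟨-, hρ⟩ | ⟨-, rfl⟩, hG⟩
    · exact ⟨Ioo_subset_Ico_self hρ, (hfix _ (Ioo_subset_Ico_self hρ)).1 hG⟩
    · exact ⟨by simp, (hfix _ (by simp)).1 hG⟩
  · rintro ⟨hρ, hD⟩
    refine ⟨?_, (hfix _ hρ).2 hD⟩
    rcases (h.nonneg 1).eq_or_lt with h1 | h1
    · refine Or.inr ⟨h1.symm, hinj (Ico_subset_Icc_self hρ) (by simp) ?_⟩
      rw [hD, h.chordSlope_zero, ← h1, sub_zero]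
    · refine Or.inl ⟨h1, lt_of_le_of_ne hρ.1 ?_, hρ.2⟩
      rintro rfl
      rw [h.chordSlope_zero] at hD
      linarith

theorem existsUnique_isRoot (hc : 0 < criticality p) : ∃! ρ : ℝ, IsRoot p ρ := by
  simp only [h.isRoot_iff hc]
  have hmono := h.strictMonoOn_chordSlope hc
  have hmem : mean p ∈ Icc (chordSlope p 0) (chordSlope p 1) := by
    rw [h.chordSlope_zero, h.chordSlope_one]
    constructor <;> linarith [h.nonneg 1]
  obtain ⟨ρ, hρ, hD⟩ := intermediate_value_Icc zero_le_one h.continuousOn_chordSlope hmem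
  refine ⟨ρ, ⟨⟨hρ.1, lt_of_le_of_ne hρ.2 ?_⟩, hD⟩, fun σ hσ =>
    hmono.injOn (Ico_subset_Icc_self hσ.1) hρ (hσ.2.trans hD.symm)⟩
  rintro rfl
  rw [h.chordSlope_one] at hD
  linarith

theorem isThreshold_of_isRoot (hc : 0 < criticality p) {ρ : ℝ} (hρ : IsRoot p ρ) :
    IsThreshold p ρ := by
  obtain ⟨hmem, hD⟩ := (h.isRoot_iff hc).1 hρ
  have hmem' := Ico_subset_Icc_self hmem
  have hm := h.mean_pos
  refine ⟨hmem', by rw [h.edgeSeries_eq, hρ.2]; ring, fun z hz => ?_, fun z hz => ?_,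
    fun z hz => (h.driftSeries_mono hz.1 hz.2 hmem'.2).trans ?_⟩
  · have hz' : z ∈ Icc (0 : ℝ) 1 := ⟨hmem'.1.trans hz.1, hz.2⟩
    have h1 := h.edgeSeries_sub hz'
    have h2 := h.monotoneOn_chordSlope hmem' hz' hz.1
    have h3 : 0 ≤ z * (1 - z) := mul_nonneg hz'.1 (by linarith [hz.2])
    nlinarith
  · have hz' : z ∈ Icc (0 : ℝ) 1 := ⟨hz.1, hz.2.trans hmem'.2⟩
    have h1 := h.edgeSeries_sub hz'
    have h2 := h.monotoneOn_chordSlope hz' hmem' hz.2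
    have h3 : 0 ≤ z * (1 - z) := mul_nonneg hz'.1 (by linarith [hz'.2])
    nlinarith
  -- The drift at `ρ` is `μ ρ (G₁'(ρ) - 1)`. By convexity the tangent slope of `μ G₁` at `ρ` is at
  -- most the chord slope `μ`; in coefficients, `(k + 1) ρ ^ k ≤ ∑_{i ≤ k} ρ ^ i`.
  · have h1 : driftSeries p ρ = (∑' k : ℕ, (k : ℝ) * ((k : ℝ) - 1) * p k * ρ ^ (k - 1)) -
        mean p * ρ := by
      have h3 := h.mean_mul_G₁ ρ
      rw [hρ.2] at h3
      rw [h3, ← (h.summable_pred_mul_pow hmem').tsum_sub (h.summable_edgeSeries_pred hmem'),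
        driftSeries]
      exact tsum_congr fun k => by ring
    have h2 : ∑' k : ℕ, (k : ℝ) * ((k : ℝ) - 1) * p k * ρ ^ (k - 1) ≤ ρ * chordSlope p ρ := by
      rw [chordSlope, ← tsum_mul_left]
      refine (h.summable_pred_mul_pow hmem').tsum_le_tsum (fun k => ?_)
        ((h.summable_chordSlope hmem').mul_left ρ)
      rcases k with _ | _ | k
      · simp
      · simp
      · have : ((k + 1 : ℕ) : ℝ) * ρ ^ k ≤ ∑ i ∈ Finset.range (k + 1), ρ ^ i := by
          rw [← nsmul_eq_mul]
          refine (le_of_eq ?_).trans (Finset.card_nsmul_le_sum _ _ (ρ ^ k) fun i hi => ?_)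
          · simp
          · exact pow_le_pow_of_le_one hmem'.1 hmem'.2 (Nat.lt_succ_iff.1 (Finset.mem_range.1 hi))
        have h3 := mul_le_mul_of_nonneg_left this
          (mul_nonneg hmem'.1 (h.mul_nonneg' (k + 2)))
        simp only [show k + 1 + 1 - 1 = k + 1 by omega]
        push_cast at h3 ⊢
        calc _ = ρ * (((k : ℝ) + 2) * p (k + 2)) * (((k : ℝ) + 1) * ρ ^ k) := by ring
          _ ≤ _ := h3
          _ = _ := by ring
    rw [h1]
    rw [hD] at h2
    linarith

end FiniteSecondMoment

/-! ### States, their rates, and continuous paths of states. -/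

/-- Non-negative sequences dominated by `p` in the coordinates `k ≥ 1`. -/
def IsState (p v : ℕ → ℝ) : Prop := ∀ k, 0 ≤ v k ∧ (1 ≤ k → v k ≤ p k)

theorem IsState.mul_nonneg {p v : ℕ → ℝ} (hv : IsState p v) (k : ℕ) : 0 ≤ (k : ℝ) * v k :=
  _root_.mul_nonneg k.cast_nonneg (hv k).1

theorem IsState.mul_le {p v : ℕ → ℝ} (hv : IsState p v) (k : ℕ) :
    (k : ℝ) * v k ≤ (k : ℝ) * p k := by
  rcases Nat.eq_zero_or_pos k with rfl | hk
  · simp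
  · exact mul_le_mul_of_nonneg_left ((hv k).2 hk) k.cast_nonneg

theorem IsState.summable {p v : ℕ → ℝ} (hv : IsState p v) (h : FiniteSecondMoment p) :
    Summable fun k : ℕ => (k : ℝ) * v k :=
  h.summable_mul.of_nonneg_of_le hv.mul_nonneg hv.mul_le

theorem IsState.totalRate_eq {p v : ℕ → ℝ} (hv : IsState p v) :
    totalRate v = v 0 + ∑' k : ℕ, (k : ℝ) * v k := by
  rw [totalRate, max_eq_left (hv 0).1]

theorem IsState.zero_le_totalRate {p v : ℕ → ℝ} (hv : IsState p v) : v 0 ≤ totalRate v := by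
  rw [hv.totalRate_eq]
  exact le_add_of_nonneg_right (tsum_nonneg hv.mul_nonneg)

theorem IsState.mul_le_totalRate {p v : ℕ → ℝ} (hv : IsState p v) (h : FiniteSecondMoment p)
    (k : ℕ) : (k : ℝ) * v k ≤ totalRate v := by
  rw [hv.totalRate_eq]
  have := (hv.summable h).le_tsum k fun j _ => hv.mul_nonneg j
  linarith [(hv 0).1]

theorem IsState.totalRate_pos {p v : ℕ → ℝ} (hv : IsState p v) (h : FiniteSecondMoment p)
    {k : ℕ} (hk : 0 < v k) : 0 < totalRate v := by
  rcases Nat.eq_zero_or_pos k with rfl | hk'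
  · exact hk.trans_le hv.zero_le_totalRate
  · have : (0 : ℝ) < k := by exact_mod_cast hk'
    exact (by positivity : 0 < (k : ℝ) * v k).trans_le (hv.mul_le_totalRate h k)

theorem rate_of_pos {v : ℕ → ℝ} (hr : 0 < totalRate v) {k : ℕ} (hk : 1 ≤ k) :
    rate k v = (k : ℝ) * v k / totalRate v := by
  rw [rate, if_pos hr, if_neg (by omega)]

theorem IsState.rate_zero_of_pos {p v : ℕ → ℝ} (hv : IsState p v) (hr : 0 < totalRate v) :
    rate 0 v = v 0 / totalRate v := by
  rw [rate, if_pos hr, if_pos rfl, max_eq_left (hv 0).1]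

theorem IsState.hasSum_rate {p v : ℕ → ℝ} (hv : IsState p v) (h : FiniteSecondMoment p) :
    HasSum (fun k => rate k v) (if 0 < totalRate v then 1 else 0) := by
  by_cases hr : 0 < totalRate v
  · rw [if_pos hr]
    have h1 : HasSum (fun k : ℕ => if k = 0 then v 0 / totalRate v else 0)
        (v 0 / totalRate v) := hasSum_ite_eq 0 _
    have h2 := h1.add ((hv.summable h).hasSum.div_const (totalRate v))
    rw [← add_div, ← hv.totalRate_eq, div_self hr.ne'] at h2
    refine h2.congr_fun fun k => ?_
    rcases Nat.eq_zero_or_pos k with rfl | hk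
    · simp [hv.rate_zero_of_pos hr]
    · simp [rate_of_pos hr hk, hk.ne']
  · rw [if_neg hr]
    refine hasSum_zero.congr_fun fun k => ?_
    simp [rate, hr]

theorem IsState.rate_nonneg {p v : ℕ → ℝ} (hv : IsState p v) (k : ℕ) : 0 ≤ rate k v := by
  rw [rate]
  split_ifs with h1 h2
  · exact div_nonneg (le_max_right _ _) h1.le
  · exact div_nonneg (hv.mul_nonneg k) h1.le
  · exact le_rfl

theorem IsState.rate_le_one {p v : ℕ → ℝ} (hv : IsState p v) (h : FiniteSecondMoment p)
    (k : ℕ) : rate k v ≤ 1 := by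
  refine (le_hasSum (hv.hasSum_rate h) k fun j _ => hv.rate_nonneg j).trans ?_
  split_ifs <;> norm_num

/-- Continuous paths of states on `[0, T]`. -/
structure IsStatePath (p : ℕ → ℝ) (T : ℝ) (x : ℝ → ℕ → ℝ) : Prop where
  nonneg : 0 ≤ T
  continuousOn : ContinuousOn x (Icc 0 T)
  state : ∀ t ∈ Icc 0 T, IsState p (x t)

/-- The time in `[a, b]` during which the total rate is positive. -/
def activeTime (x : ℝ → ℕ → ℝ) (a b : ℝ) : ℝ :=
  ∫ s in a..b, if 0 < totalRate (x s) then (1 : ℝ) else 0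

namespace IsStatePath

variable {p : ℕ → ℝ} {T : ℝ} {x : ℝ → ℕ → ℝ} (hx : IsStatePath p T x)
include hx

/-- Freezing the path outside `[0, T]` makes it continuous on all of `ℝ`, which yields measurability
and two-sided derivatives of primitives. -/
theorem continuous_proj : Continuous fun s => x (projIcc 0 T hx.nonneg s) :=
  hx.continuousOn.domRestrict.comp continuous_projIcc

theorem state_proj (s : ℝ) : IsState p (x (projIcc 0 T hx.nonneg s)) :=
  hx.state _ (projIcc 0 T hx.nonneg s).2

/-- Coordinatewise continuity alone does not pass to the infinite sum; domination by the summable `k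
pₖ` does it. -/
theorem continuous_totalRate_proj (h : FiniteSecondMoment p) :
    Continuous fun s => totalRate (x (projIcc 0 T hx.nonneg s)) := by
  have hc : ∀ k, Continuous fun s => x (projIcc 0 T hx.nonneg s) k :=
    fun k => (continuous_apply k).comp hx.continuous_proj
  refine Continuous.add ((hc 0).max continuous_const)
    (continuous_tsum (fun k => (hc k).const_mul _) h.summable_mul fun k s => ?_)
  rw [Real.norm_of_nonneg ((hx.state_proj s).mul_nonneg k)]
  exact (hx.state_proj s).mul_le k

theorem proj_eq {s : ℝ} (hs : s ∈ Icc 0 T) : x (projIcc 0 T hx.nonneg s) = x s := by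
  rw [projIcc_of_mem _ hs]

theorem continuousOn_totalRate (h : FiniteSecondMoment p) :
    ContinuousOn (fun s => totalRate (x s)) (Icc 0 T) :=
  (hx.continuous_totalRate_proj h).continuousOn.congr fun s hs => by simp only [hx.proj_eq hs]

theorem continuousOn_coord (k : ℕ) : ContinuousOn (fun s => x s k) (Icc 0 T) :=
  (continuous_apply k).comp_continuousOn hx.continuousOn

theorem measurable_rate_proj (h : FiniteSecondMoment p) (k : ℕ) :
    Measurable fun s => rate k (x (projIcc 0 T hx.nonneg s)) := by
  have hr := (hx.continuous_totalRate_proj h).measurable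
  have hc : ∀ k, Measurable fun s => x (projIcc 0 T hx.nonneg s) k :=
    fun k => ((continuous_apply k).comp hx.continuous_proj).measurable
  refine Measurable.ite (measurableSet_lt measurable_const hr) ?_ measurable_const
  refine Measurable.div ?_ hr
  by_cases hk : k = 0
  · simpa [hk] using (hc 0).max measurable_const
  · simpa [hk] using (hc k).const_mul _

theorem integrableOn_rate (h : FiniteSecondMoment p) (k : ℕ) :
    IntegrableOn (fun s => rate k (x s)) (Icc 0 T) := by
  have h1 : IntegrableOn (fun s => rate k (x (projIcc 0 T hx.nonneg s))) (Icc 0 T) := by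
    refine Measure.integrableOn_of_bounded (M := 1) (by simp)
      (hx.measurable_rate_proj h k).aestronglyMeasurable (ae_of_all _ fun s => ?_)
    rw [Real.norm_of_nonneg ((hx.state_proj s).rate_nonneg k)]
    exact (hx.state_proj s).rate_le_one h k
  exact h1.congr_fun (fun s hs => by simp only [hx.proj_eq hs]) measurableSet_Icc

theorem integrableOn_active (h : FiniteSecondMoment p) :
    IntegrableOn (fun s => if 0 < totalRate (x s) then (1 : ℝ) else 0) (Icc 0 T) := by
  have h1 : IntegrableOn (fun s => if 0 < totalRate (x (projIcc 0 T hx.nonneg s)) then (1 : ℝ)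
      else 0) (Icc 0 T) := by
    refine Measure.integrableOn_of_bounded (M := 1) (by simp)
      (Measurable.ite (measurableSet_lt measurable_const
        (hx.continuous_totalRate_proj h).measurable) measurable_const
        measurable_const).aestronglyMeasurable (ae_of_all _ fun s => ?_)
    split_ifs <;> simp
  exact h1.congr_fun (fun s hs => by simp only [hx.proj_eq hs]) measurableSet_Icc

omit hx in
theorem _root_.MeasureTheory.IntegrableOn.intervalIntegrable_of_mem {f : ℝ → ℝ} {a b c d : ℝ}
    (hf : IntegrableOn f (Icc c d)) (ha : a ∈ Icc c d) (hb : b ∈ Icc c d) :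
    IntervalIntegrable f volume a b :=
  (hf.mono_set (uIcc_subset_Icc ha hb)).intervalIntegrable

theorem intervalIntegrable_rate (h : FiniteSecondMoment p) (k : ℕ) {a b : ℝ} (ha : a ∈ Icc 0 T)
    (hb : b ∈ Icc 0 T) : IntervalIntegrable (fun s => rate k (x s)) volume a b :=
  (hx.integrableOn_rate h k).intervalIntegrable_of_mem ha hb

theorem intervalIntegrable_active (h : FiniteSecondMoment p) {a b : ℝ} (ha : a ∈ Icc 0 T)
    (hb : b ∈ Icc 0 T) :
    IntervalIntegrable (fun s => if 0 < totalRate (x s) then (1 : ℝ) else 0) volume a b :=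
  (hx.integrableOn_active h).intervalIntegrable_of_mem ha hb

theorem hasSum_integral_rate (h : FiniteSecondMoment p) {a b : ℝ} (ha : a ∈ Icc 0 T)
    (hb : b ∈ Icc 0 T) :
    HasSum (fun k => ∫ s in a..b, rate k (x s)) (activeTime x a b) := by
  have hsub : uIoc a b ⊆ Icc 0 T := uIoc_subset_uIcc.trans (uIcc_subset_Icc ha hb)
  refine intervalIntegral.hasSum_integral_of_dominated_convergence (fun k s => rate k (x s))
    (fun k => ((hx.integrableOn_rate h k).mono_set hsub).aestronglyMeasurable)
    (fun k => ae_of_all _ fun s hs => ?_) (ae_of_all _ fun s hs => ?_) ?_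
    (ae_of_all _ fun s hs => ?_)
  · rw [Real.norm_of_nonneg ((hx.state s (hsub hs)).rate_nonneg k)]
  · exact ((hx.state s (hsub hs)).hasSum_rate h).summable
  · refine (hx.intervalIntegrable_active h ha hb).congr fun s hs => ?_
    exact ((hx.state s (hsub hs)).hasSum_rate h).tsum_eq.symm
  · exact (hx.state s (hsub hs)).hasSum_rate h

theorem activeTime_le (h : FiniteSecondMoment p) {a b : ℝ} (ha : a ∈ Icc 0 T)
    (hb : b ∈ Icc 0 T) (hab : a ≤ b) : activeTime x a b ≤ b - a := by
  have := intervalIntegral.integral_mono_on hab (hx.intervalIntegrable_active h ha hb)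
    (intervalIntegrable_const (c := (1 : ℝ))) fun s _ => by split_ifs <;> norm_num
  simpa [activeTime] using this

omit hx in
theorem activeTime_eq {a b : ℝ} (hab : a ≤ b) (hr : ∀ s ∈ Ioo a b, 0 < totalRate (x s)) :
    activeTime x a b = b - a := by
  have : activeTime x a b = ∫ _ in a..b, (1 : ℝ) := by
    refine intervalIntegral.integral_congr_ae ?_
    have hb : ∀ᵐ s : ℝ, s ≠ b := by simp [ae_iff]
    filter_upwards [hb] with s hs hs'
    rw [uIoc_of_le hab] at hs'
    rw [if_pos (hr s ⟨hs'.1, lt_of_le_of_ne hs'.2 hs⟩)]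
  rw [this]
  simp

theorem activeTime_add (h : FiniteSecondMoment p) {a b c : ℝ} (ha : a ∈ Icc 0 T)
    (hb : b ∈ Icc 0 T) (hc : c ∈ Icc 0 T) :
    activeTime x a b + activeTime x b c = activeTime x a c :=
  intervalIntegral.integral_add_adjacent_intervals (hx.intervalIntegrable_active h ha hb)
    (hx.intervalIntegrable_active h hb hc)

end IsStatePath

/-! ### Fluid paths and their one-parameter form. -/

/-- Solutions of the fluid limit equations without the reflection constraint. -/
structure IsFluidPath (p : ℕ → ℝ) (T : ℝ) (x : ℝ → ℕ → ℝ) (y : ℝ → ℝ) : Prop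
    extends IsStatePath p T x where
  eq : ∀ t ∈ Icc 0 T, ∀ k, 1 ≤ k → x t k = p k - ∫ s in (0 : ℝ)..t, rate k (x s)
  hasSum : ∀ t ∈ Icc 0 T,
    HasSum (fun k : ℕ => ((k : ℝ) - 2) * ∫ s in (0 : ℝ)..t, rate k (x s)) (y t)

namespace IsFluidPath

variable {p : ℕ → ℝ} {T : ℝ} {x : ℝ → ℕ → ℝ} {y : ℝ → ℝ} (hx : IsFluidPath p T x y)
include hx

theorem zero_mem : (0 : ℝ) ∈ Icc 0 T := ⟨le_rfl, hx.nonneg⟩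

theorem initial {k : ℕ} (hk : 1 ≤ k) : x 0 k = p k := by
  simpa using hx.eq 0 hx.zero_mem k hk

theorem sub_eq (h : FiniteSecondMoment p) {a b : ℝ} (ha : a ∈ Icc 0 T) (hb : b ∈ Icc 0 T)
    {k : ℕ} (hk : 1 ≤ k) : x a k - x b k = ∫ s in a..b, rate k (x s) := by
  rw [hx.eq a ha k hk, hx.eq b hb k hk, ← intervalIntegral.integral_interval_sub_left
    (hx.intervalIntegrable_rate h k hx.zero_mem hb) (hx.intervalIntegrable_rate h k hx.zero_mem ha)]
  ring

theorem integral_rate_nonneg {a b : ℝ} (ha : a ∈ Icc 0 T) (hb : b ∈ Icc 0 T) (hab : a ≤ b)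
    (k : ℕ) : 0 ≤ ∫ s in a..b, rate k (x s) :=
  intervalIntegral.integral_nonneg hab fun s hs =>
    (hx.state s ⟨ha.1.trans hs.1, hs.2.trans hb.2⟩).rate_nonneg k

theorem antitoneOn (h : FiniteSecondMoment p) {k : ℕ} (hk : 1 ≤ k) :
    AntitoneOn (fun t => x t k) (Icc 0 T) := fun a ha b hb hab => by
  have := hx.sub_eq h ha hb hk
  have := hx.integral_rate_nonneg ha hb hab k
  simp only
  linarith

/-- Split `k - 2`: the part `k` sums to the loss of `∑ k ζₖ`, and the part `2` sums to twice the
active time because the rates add up to 1 while active. -/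
theorem netflow_eq (h : FiniteSecondMoment p) {t : ℝ} (ht : t ∈ Icc 0 T) :
    y t = mean p - 2 * activeTime x 0 t - ∑' k : ℕ, (k : ℝ) * x t k := by
  have h1 := (hx.hasSum t ht).add ((hx.hasSum_integral_rate h hx.zero_mem ht).mul_left 2)
  have h2 := h.summable_mul.hasSum.sub ((hx.state t ht).summable h).hasSum
  have h3 : y t + 2 * activeTime x 0 t = mean p - ∑' k : ℕ, (k : ℝ) * x t k := by
    refine h1.unique (h2.congr_fun fun k => ?_)
    rcases Nat.eq_zero_or_pos k with rfl | hk
    · simp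
    · rw [hx.eq t ht k hk]
      ring
  linarith

theorem netflow_zero (h : FiniteSecondMoment p) : y 0 = 0 := by
  rw [hx.netflow_eq h hx.zero_mem]
  have : ∑' k : ℕ, (k : ℝ) * x 0 k = mean p := tsum_congr fun k => by
    rcases Nat.eq_zero_or_pos k with rfl | hk
    · simp
    · rw [hx.initial hk]
  simp [this, activeTime]

theorem continuousOn_netflow (h : FiniteSecondMoment p) : ContinuousOn y (Icc 0 T) := by
  have h1 : ContinuousOn (fun t => activeTime x 0 t) (Icc 0 T) := by
    have := intervalIntegral.continuousOn_primitive_interval (a := 0) (b := T)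
      (f := fun s => if 0 < totalRate (x s) then (1 : ℝ) else 0) (μ := volume)
      (by rw [uIcc_of_le hx.nonneg]; exact hx.integrableOn_active h)
    rwa [uIcc_of_le hx.nonneg] at this
  have h2 : ContinuousOn (fun t => totalRate (x t) - x t 0) (Icc 0 T) :=
    (hx.continuousOn_totalRate h).sub (hx.continuousOn_coord 0)
  refine ((continuousOn_const (c := mean p)).sub (h1.const_mul 2)|>.sub h2).congr fun t ht => ?_
  simp only [Pi.sub_apply, hx.netflow_eq h ht, (hx.state t ht).totalRate_eq]
  ring

/-- Integrating factor: `x k * exp (k ∫ 1/r)` has derivative 0. The exponential does not depend on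
`k`. -/
theorem eq_exp (h : FiniteSecondMoment p) {t : ℝ} (ht : t ∈ Icc 0 T)
    (hr : ∀ s ∈ Icc 0 t, 0 < totalRate (x s)) {k : ℕ} (hk : 1 ≤ k) :
    x t k = p k * Real.exp (-∫ s in (0 : ℝ)..t, (totalRate (x s))⁻¹) ^ k := by
  have hsub : Icc 0 t ⊆ Icc 0 T := Icc_subset_Icc_right ht.2
  have hxt : IsStatePath p t x :=
    ⟨ht.1, hx.continuousOn.mono hsub, fun s hs => hx.state s (hsub hs)⟩
  set g : ℝ → ℝ := fun s => (totalRate (x (projIcc 0 t ht.1 s)))⁻¹ with hg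
  have hgc : Continuous g := (hxt.continuous_totalRate_proj h).inv₀ fun s =>
    (hr _ (projIcc 0 t ht.1 s).2).ne'
  set q : ℝ → ℝ := fun s => (k : ℝ) * x (projIcc 0 t ht.1 s) k * g s with hq
  have hqc : Continuous q :=
    (((continuous_apply k).comp hxt.continuous_proj).const_mul _).mul hgc
  have hP : ∀ s ∈ Icc 0 t, p k - ∫ u in (0 : ℝ)..s, q u = x s k := by
    intro s hs
    rw [hx.eq s (hsub hs) k hk]
    congr 1
    refine intervalIntegral.integral_congr fun u hu => ?_
    rw [uIcc_of_le hs.1] at hu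
    have hu' : u ∈ Icc 0 t := ⟨hu.1, hu.2.trans hs.2⟩
    simp only [hq, hg, hxt.proj_eq hu', rate_of_pos (hr u hu') hk, div_eq_mul_inv]
  have hE : ∫ u in (0 : ℝ)..t, g u = ∫ s in (0 : ℝ)..t, (totalRate (x s))⁻¹ := by
    refine intervalIntegral.integral_congr fun u hu => ?_
    rw [uIcc_of_le ht.1] at hu
    simp only [hg, hxt.proj_eq hu]
  have hderiv : ∀ s, HasDerivAt (fun s => (p k - ∫ u in (0 : ℝ)..s, q u) *
      Real.exp (k * ∫ u in (0 : ℝ)..s, g u))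
      (-q s * Real.exp (k * ∫ u in (0 : ℝ)..s, g u) + (p k - ∫ u in (0 : ℝ)..s, q u) *
        (Real.exp (k * ∫ u in (0 : ℝ)..s, g u) * (k * g s))) s := fun s =>
    ((hqc.integral_hasStrictDerivAt 0 s).hasDerivAt.const_sub (p k)).mul
      (((hgc.integral_hasStrictDerivAt 0 s).hasDerivAt.const_mul (k : ℝ)).exp)
  have hconst := constant_of_has_deriv_right_zero (a := 0) (b := t)
    (fun s _ => (hderiv s).continuousAt.continuousWithinAt)
    (fun s hs => by
      have hd := (hderiv s).hasDerivWithinAt (s := Ici s)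
      have hs' : s ∈ Icc 0 t := Ico_subset_Icc_self hs
      have : -q s * Real.exp (k * ∫ u in (0 : ℝ)..s, g u) + (p k - ∫ u in (0 : ℝ)..s, q u) *
        (Real.exp (k * ∫ u in (0 : ℝ)..s, g u) * (k * g s)) = 0 := by
        rw [hP s hs']
        simp only [hq, hxt.proj_eq hs']
        ring
      rwa [this] at hd) t ⟨ht.1, le_rfl⟩
  rw [hP t ⟨ht.1, le_rfl⟩, hE] at hconst
  simp only [intervalIntegral.integral_same, mul_zero, Real.exp_zero, sub_zero, mul_one] at hconst
  rw [← hconst, ← Real.exp_nat_mul, mul_assoc, ← Real.exp_add]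
  simp

theorem exists_eq_mul_pow (h : FiniteSecondMoment p) :
    ∃ z : ℝ → ℝ, AntitoneOn z (Icc 0 T) ∧ (∀ t ∈ Icc 0 T, z t ∈ Icc (0 : ℝ) 1) ∧
      (∀ t ∈ Icc 0 T, ∀ k, 1 ≤ k → x t k = p k * z t ^ k) := by
  classical
  set J : ℝ → ℝ := fun t => ∫ s in (0 : ℝ)..t, (totalRate (x s))⁻¹ with hJ
  have hJm : ∀ s ∈ Icc 0 T, ∀ t ∈ Icc 0 T, s ≤ t → (∃ k, 1 ≤ k ∧ 0 < x t k) → J s ≤ J t := by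
    rintro s hs t ht hst ⟨k, hk, hxk⟩
    have hpos : ∀ u ∈ Icc 0 t, 0 < totalRate (x u) := fun u hu =>
      (hx.state u ⟨hu.1, hu.2.trans ht.2⟩).totalRate_pos h
        (hxk.trans_le (hx.antitoneOn h hk ⟨hu.1, hu.2.trans ht.2⟩ ht hu.2))
    have hint : IntervalIntegrable (fun u => (totalRate (x u))⁻¹) volume 0 t := by
      refine ContinuousOn.intervalIntegrable ?_
      rw [uIcc_of_le ht.1]
      exact ((hx.continuousOn_totalRate h).mono (Icc_subset_Icc_right ht.2)).inv₀
        fun u hu => (hpos u hu).ne'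
    refine intervalIntegral.integral_mono_interval le_rfl hs.1 hst ?_ hint
    filter_upwards [ae_restrict_mem measurableSet_Ioc] with u hu
    exact inv_nonneg.2 (hpos u (Ioc_subset_Icc_self hu)).le
  have hdown : ∀ s ∈ Icc 0 T, ∀ t ∈ Icc 0 T, s ≤ t → (∃ k, 1 ≤ k ∧ 0 < x t k) →
      ∃ k, 1 ≤ k ∧ 0 < x s k := fun s hs t ht hst ⟨k, hk, hxk⟩ =>
    ⟨k, hk, hxk.trans_le (hx.antitoneOn h hk hs ht hst)⟩
  -- Once all coordinates `k ≥ 1` have died, `1/r` may fail to be integrable and the default value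
  -- of `∫` would give `exp 0 = 1`; the value 0 has to be imposed.
  refine ⟨fun t => if ∃ k, 1 ≤ k ∧ 0 < x t k then Real.exp (-J t) else 0, ?_, ?_, ?_⟩
  · intro s hs t ht hst
    by_cases hal : ∃ k, 1 ≤ k ∧ 0 < x t k
    · simp only [if_pos hal, if_pos (hdown s hs t ht hst hal)]
      exact Real.exp_le_exp.2 (neg_le_neg (hJm s hs t ht hst hal))
    · simp only [if_neg hal]
      split_ifs
      · exact (Real.exp_pos _).le
      · exact le_rfl
  · intro t ht
    simp only
    split_ifs with hal
    · refine ⟨(Real.exp_pos _).le, Real.exp_le_one_iff.2 ?_⟩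
      have := hJm 0 hx.zero_mem t ht ht.1 hal
      simp only [hJ, intervalIntegral.integral_same] at this ⊢
      linarith
    · simp
  · intro t ht k hk
    simp only
    split_ifs with hal
    · obtain ⟨j, hj, hxj⟩ := hal
      exact hx.eq_exp h ht (fun u hu => (hx.state u ⟨hu.1, hu.2.trans ht.2⟩).totalRate_pos h
        (hxj.trans_le (hx.antitoneOn h hj ⟨hu.1, hu.2.trans ht.2⟩ ht hu.2))) hk
    · push Not at hal
      rw [le_antisymm (hal k hk) ((hx.state t ht) k).1, zero_pow (by omega), mul_zero]

end IsFluidPath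

/-! ### The explicit profile -/

/-- The function `z` for which the explicit path is `ζₖ(t) = pₖ z(t)ᵏ`, `k ≥ 1`. -/
def profile (p : ℕ → ℝ) (ρ t : ℝ) : ℝ :=
  if t ≤ tau p ρ then √(1 - 2 * t / mean p) else ρ * fInv p ρ (t - tau p ρ)

namespace IsThreshold

variable {p : ℕ → ℝ} {ρ : ℝ} (hρ : IsThreshold p ρ) (h : FiniteSecondMoment p)
include hρ h

theorem tau_nonneg : 0 ≤ tau p ρ :=
  mul_nonneg (by linarith [h.mean_pos]) (by nlinarith [hρ.mem.1, hρ.mem.2])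

omit hρ in
theorem tau_le : tau p ρ ≤ mean p / 2 :=
  mul_le_of_le_one_right (by linarith [h.mean_pos]) (by nlinarith [sq_nonneg ρ])

omit hρ in
theorem one_sub_tau : 1 - 2 * tau p ρ / mean p = ρ ^ 2 := by
  have := h.mean_pos.ne'
  rw [tau]
  field_simp
  ring

omit hρ in
theorem sq_le_of_le_tau {t : ℝ} (ht : t ≤ tau p ρ) : ρ ^ 2 ≤ 1 - 2 * t / mean p := by
  have := h.mean_pos
  rw [← one_sub_tau h]
  gcongr

omit hρ in
theorem profile_sq {t : ℝ} (ht : t ≤ tau p ρ) : profile p ρ t ^ 2 = 1 - 2 * t / mean p := by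
  rw [profile, if_pos ht, Real.sq_sqrt ((sq_nonneg ρ).trans (sq_le_of_le_tau h ht))]

theorem profile_tau : profile p ρ (tau p ρ) = ρ := by
  rw [profile, if_pos le_rfl, one_sub_tau h, Real.sqrt_sq hρ.mem.1]

omit hρ in
theorem profile_mem_of_le {t : ℝ} (h0 : 0 ≤ t) (ht : t ≤ tau p ρ) :
    profile p ρ t ∈ Icc ρ 1 := by
  have hm := h.mean_pos
  rw [profile, if_pos ht]
  refine ⟨Real.le_sqrt_of_sq_le (sq_le_of_le_tau h ht), Real.sqrt_le_one.2 ?_⟩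
  have : 0 ≤ 2 * t / mean p := by positivity
  linarith

theorem fInv_spec (h0 : 0 < ρ) {t : ℝ} (ht : t ∈ Icc 0 (G₀ p ρ)) :
    fInv p ρ t ∈ Icc (0 : ℝ) 1 ∧ G₀ p (ρ * fInv p ρ t) = G₀ p ρ - t := by
  have hex : ∃ u ∈ Icc (0 : ℝ) 1, F p ρ u = t := by
    have hc : ContinuousOn (F p ρ) (Icc 0 1) := by
      refine continuousOn_const.sub (h.continuousOn_G₀.comp (by fun_prop) fun u hu => ?_)
      exact ⟨mul_nonneg hρ.mem.1 hu.1, mul_le_one₀ hρ.mem.2 hu.1 hu.2⟩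
    have := intermediate_value_Icc' zero_le_one hc
    simp only [F, mul_one, sub_self, mul_zero, h.G₀_zero, sub_zero] at this
    exact this ht
  rw [fInv, if_neg h0.ne', if_pos ht.2]
  have h1 := Function.invFunOn_eq hex
  refine ⟨Function.invFunOn_mem hex, ?_⟩
  rw [F] at h1
  linarith

/-- Covers both branches of `fInv` and the case `ρ = 0` at once; injectivity of `G₀` makes it a
characterisation. -/
theorem profile_spec {t : ℝ} (ht : tau p ρ ≤ t) :
    profile p ρ t ∈ Icc 0 ρ ∧ G₀ p (profile p ρ t) = max (G₀ p ρ - (t - tau p ρ)) 0 := by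
  have hG := h.strictMonoOn_G₀.monotoneOn (by simp) hρ.mem hρ.mem.1
  rw [h.G₀_zero] at hG
  rcases ht.eq_or_lt with rfl | ht'
  · rw [hρ.profile_tau h]
    simp [hρ.mem.1, hG]
  rw [profile, if_neg ht'.not_ge]
  rcases hρ.mem.1.eq_or_lt with rfl | h0
  · rw [zero_mul, h.G₀_zero, max_eq_right (by linarith)]
    simp
  rcases le_or_gt (t - tau p ρ) (G₀ p ρ) with hle | hlt
  · obtain ⟨h1, h2⟩ := hρ.fInv_spec h h0 ⟨sub_nonneg.2 ht, hle⟩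
    rw [h2, max_eq_left (by linarith)]
    exact ⟨⟨mul_nonneg hρ.mem.1 h1.1, mul_le_of_le_one_right hρ.mem.1 h1.2⟩, rfl⟩
  · rw [fInv, if_neg h0.ne', if_neg hlt.not_ge, mul_zero, h.G₀_zero, max_eq_right (by linarith)]
    simp [hρ.mem.1]

theorem profile_mem {t : ℝ} (h0 : 0 ≤ t) : profile p ρ t ∈ Icc (0 : ℝ) 1 := by
  rcases le_total t (tau p ρ) with ht | ht
  · exact Icc_subset_Icc_left hρ.mem.1 (profile_mem_of_le h h0 ht)
  · exact Icc_subset_Icc_right hρ.mem.2 (hρ.profile_spec h ht).1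

omit hρ in
theorem zetaSup_eq {t : ℝ} {k : ℕ} (hk : 1 ≤ k) :
    zetaSup p ρ t k = p k * profile p ρ t ^ k := by
  rw [zetaSup, if_neg (by omega), profile]
  split_ifs with ht
  · have hnn := (sq_nonneg ρ).trans (sq_le_of_le_tau h ht)
    rw [Real.sqrt_eq_rpow, ← Real.rpow_natCast, ← Real.rpow_mul hnn]
    congr 2
    ring
  · rw [mul_pow, mul_assoc]

omit hρ in
theorem zetaSup_zero_of_le {t : ℝ} (ht : t ≤ tau p ρ) :
    zetaSup p ρ t 0 = mean p * profile p ρ t ^ 2 - edgeSeries p (profile p ρ t) := by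
  have hm := h.mean_pos.ne'
  rw [zetaSup, if_pos rfl, if_pos ht, profile_sq h ht, h.edgeSeries_eq, profile, if_pos ht]
  congr 1
  field_simp

theorem zetaSup_zero_of_ge {t : ℝ} (ht : tau p ρ ≤ t) : zetaSup p ρ t 0 = 0 := by
  rcases ht.eq_or_lt with rfl | ht'
  · rw [zetaSup_zero_of_le h le_rfl, hρ.profile_tau h, hρ.edgeSeries_eq, sub_self]
  · rw [zetaSup, if_pos rfl, if_neg ht'.not_ge]

end IsThreshold

/-- A tangent bound, convexity term by term for `k ≥ 2` with equality for `k = 1`. It bounds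
increments of `ψ` without differentiating `z`. -/
theorem FiniteSecondMoment.drift_le {p : ℕ → ℝ} (h : FiniteSecondMoment p) {a b : ℝ}
    (ha : 0 ≤ a) (hab : a ≤ b) (hb : b ≤ 1) :
    (edgeSeries p b - 2 * G₀ p b) - (edgeSeries p a - 2 * G₀ p a) ≤
      (b - a) * driftSeries p b := by
  have ha' : a ∈ Icc (0 : ℝ) 1 := ⟨ha, hab.trans hb⟩
  have hb' : b ∈ Icc (0 : ℝ) 1 := ⟨ha.trans hab, hb⟩
  have hs : ∀ z ∈ Icc (0 : ℝ) 1,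
      HasSum (fun k : ℕ => ((k : ℝ) - 2) * p k * z ^ k) (edgeSeries p z - 2 * G₀ p z) :=
    fun z hz => ((h.summable_edgeSeries hz).hasSum.sub
      ((h.summable_G₀ hz).hasSum.mul_left 2)).congr_fun fun k => by ring
  refine hasSum_le (fun k => ?_) ((hs b hb').sub (hs a ha'))
    ((h.summable_driftSeries hb').hasSum.mul_left (b - a))
  rcases k with _ | _ | k
  · simp
  · simp only [zero_add, Nat.cast_one, pow_one, Nat.sub_self, pow_zero]
    linarith
  · have h1 : b ^ (k + 2) - a ^ (k + 2) ≤ ((k : ℝ) + 2) * b ^ (k + 1) * (b - a) := by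
      have hg := (Commute.all b a).geom_sum₂_mul (k + 2)
      rw [← hg]
      refine mul_le_mul_of_nonneg_right ?_ (sub_nonneg.2 hab)
      refine (Finset.sum_le_card_nsmul _ _ (b ^ (k + 1)) fun i hi => ?_).trans (le_of_eq ?_)
      · have hi' : i + (k + 2 - 1 - i) = k + 1 := by
          have := Finset.mem_range.1 hi
          omega
        rw [← hi', pow_add]
        exact mul_le_mul_of_nonneg_left (pow_le_pow_left₀ ha hab _) (pow_nonneg hb'.1 _)
      · simp
    have h2 : 0 ≤ (k : ℝ) * p (k + 2) := mul_nonneg k.cast_nonneg (h.nonneg _)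
    have h3 := mul_le_mul_of_nonneg_left h1 h2
    push_cast
    simp only [show k + 1 + 1 = k + 2 by omega]
    nlinarith [h3]

/-! ### The reflection map -/

theorem min_sInf_eq_zero {y : ℝ → ℝ} {t : ℝ} (h0 : 0 ≤ t) (hy : ∀ s ∈ Icc 0 t, 0 ≤ y s) :
    min (sInf (y '' Icc 0 t)) 0 = 0 := by
  refine min_eq_right (le_csInf ((nonempty_Icc.2 h0).image y) ?_)
  rintro _ ⟨s, hs, rfl⟩
  exact hy s hs

theorem min_sInf_eq_of_antitoneOn {y : ℝ → ℝ} {a T t : ℝ} (ha : 0 ≤ a)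
    (hy : ∀ s ∈ Icc 0 a, 0 ≤ y s) (hya : y a = 0) (hanti : AntitoneOn y (Icc a T))
    (ht : t ∈ Icc a T) : min (sInf (y '' Icc 0 t)) 0 = y t := by
  have h1 : y t ≤ 0 := hya ▸ hanti ⟨le_rfl, ht.1.trans ht.2⟩ ht ht.1
  have h2 : IsLeast (y '' Icc 0 t) (y t) := by
    refine ⟨⟨t, ⟨ha.trans ht.1, le_rfl⟩, rfl⟩, ?_⟩
    rintro _ ⟨s, hs, rfl⟩
    rcases le_total s a with hsa | hsa
    · exact h1.trans (hy s ⟨hs.1, hsa⟩)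
    · exact hanti ⟨hsa, hs.2.trans ht.2⟩ ht hs.2
  rw [h2.csInf_eq, min_eq_left h1]

/-! ### Uniqueness -/

/-- The value of `z²` if the total rate were exactly `c - 2 s`; bounds on the rate become bounds on
`z` by comparison. -/
theorem exp_neg_integral_inv_sq {c t : ℝ} (ht : 0 ≤ t) (hc : 2 * t < c) :
    Real.exp (-∫ s in (0 : ℝ)..t, (c - 2 * s)⁻¹) ^ 2 = (c - 2 * t) / c := by
  have hpos : ∀ s ∈ uIcc 0 t, 0 < c - 2 * s := fun s hs => by
    rw [uIcc_of_le ht] at hs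
    linarith [hs.2]
  have hint : ∫ s in (0 : ℝ)..t, (c - 2 * s)⁻¹ =
      -(1 / 2) * Real.log (c - 2 * t) - -(1 / 2) * Real.log (c - 2 * 0) := by
    refine intervalIntegral.integral_eq_sub_of_hasDerivAt
      (f := fun s => -(1 / 2) * Real.log (c - 2 * s)) (f' := fun s => (c - 2 * s)⁻¹) (fun s hs => ?_)
      (ContinuousOn.intervalIntegrable (ContinuousOn.inv₀ (by fun_prop)
        fun s hs => (hpos s hs).ne'))
    have h1 : HasDerivAt (fun s : ℝ => c - 2 * s) (-2) s := by
      simpa using ((hasDerivAt_id s).const_mul 2).const_sub c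
    have h2 := (h1.log (hpos s hs).ne').const_mul (-(1 / 2))
    convert! h2 using 1
    have := (hpos s hs).ne'
    field_simp
  have h1 : 0 < c - 2 * t := by linarith
  have h2 : 0 < c := by linarith
  rw [hint, mul_zero, sub_zero, ← Real.exp_nat_mul]
  have : ((2 : ℕ) : ℝ) * -(-(1 / 2) * Real.log (c - 2 * t) - -(1 / 2) * Real.log c) =
      Real.log ((c - 2 * t) / c) := by
    rw [Real.log_div h1.ne' h2.ne']
    push_cast
    ring
  rw [this, Real.exp_log (div_pos h1 h2)]

namespace IsFluidPath

variable {p : ℕ → ℝ} {T : ℝ} {x : ℝ → ℕ → ℝ} {y z : ℝ → ℝ} (hx : IsFluidPath p T x y)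
  (h : FiniteSecondMoment p) (hz1 : ∀ t ∈ Icc 0 T, z t ∈ Icc (0 : ℝ) 1)
  (hzx : ∀ t ∈ Icc 0 T, ∀ k, 1 ≤ k → x t k = p k * z t ^ k)

include hzx in
theorem tsum_eq_edgeSeries {t : ℝ} (ht : t ∈ Icc 0 T) :
    ∑' k : ℕ, (k : ℝ) * x t k = edgeSeries p (z t) := tsum_congr fun k => by
  rcases Nat.eq_zero_or_pos k with rfl | hk
  · simp
  · rw [hzx t ht k hk, mul_assoc]

include hx h hz1 hzx

theorem G₀_sub_eq {a b : ℝ} (ha : a ∈ Icc 0 T) (hb : b ∈ Icc 0 T) :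
    G₀ p (z a) - G₀ p (z b) = activeTime x a b - ∫ s in a..b, rate 0 (x s) := by
  have h1 := (h.summable_G₀ (hz1 a ha)).hasSum.sub (h.summable_G₀ (hz1 b hb)).hasSum
  have h2 := (hx.hasSum_integral_rate h ha hb).sub
    (hasSum_ite_eq (0 : ℕ) (∫ s in a..b, rate 0 (x s)))
  refine h1.unique (h2.congr_fun fun k => ?_)
  rcases Nat.eq_zero_or_pos k with rfl | hk
  · simp [h.zero]
  · rw [if_neg hk.ne', sub_zero, ← hx.sub_eq h ha hb hk, hzx a ha k hk, hzx b hb k hk]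

/-- With `H = edgeSeries - 2 G₀`, one has `ψ(t) - ψ(s) = H(z s) - H(z t) - 2 ∫ r₀`, and `H` is
controlled by the non-positive drift below `ρ`. Nothing about reflection is used. -/
theorem antitoneOn_netflow {ρ : ℝ} (hρ : IsThreshold p ρ) (hanti : AntitoneOn z (Icc 0 T))
    {a : ℝ} (ha : a ∈ Icc 0 T) (hle : z a ≤ ρ) : AntitoneOn y (Icc a T) := by
  intro s hs t ht hst
  have hs' : s ∈ Icc 0 T := ⟨ha.1.trans hs.1, hs.2⟩
  have ht' : t ∈ Icc 0 T := ⟨ha.1.trans ht.1, ht.2⟩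
  have h1 := hx.G₀_sub_eq h hz1 hzx hs' ht'
  have h2 := hx.integral_rate_nonneg hs' ht' hst 0
  have h3 := hx.activeTime_add h hx.zero_mem hs' ht'
  have h4 := h.drift_le (hz1 t ht').1 (hanti hs' ht' hst) (hz1 s hs').2
  have h5 := hρ.driftSeries_nonpos (z s) ⟨(hz1 s hs').1, (hanti ha hs' hs.1).trans hle⟩
  have h6 := mul_nonpos_of_nonneg_of_nonpos (sub_nonneg.2 (hanti hs' ht' hst)) h5
  rw [hx.netflow_eq h hs', hx.netflow_eq h ht', tsum_eq_edgeSeries hzx hs',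
    tsum_eq_edgeSeries hzx ht']
  linarith

theorem eq_exp_of_pos {t : ℝ} (ht : t ∈ Icc 0 T) (hr : ∀ s ∈ Icc 0 t, 0 < totalRate (x s)) :
    z t = Real.exp (-∫ s in (0 : ℝ)..t, (totalRate (x s))⁻¹) := by
  obtain ⟨k, hk, hpk⟩ := h.exists_pos
  have h1 := hx.eq_exp h ht hr hk
  rw [hzx t ht k hk] at h1
  exact (pow_left_inj₀ (hz1 t ht).1 (Real.exp_pos _).le (by omega)).1
    (mul_left_cancel₀ hpk.ne' h1)

end IsFluidPath

/-- The paths solving the fluid limit equations with reflection. -/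
structure IsReflectedPath (p : ℕ → ℝ) (T : ℝ) (x : ℝ → ℕ → ℝ) (y : ℝ → ℝ) : Prop
    extends IsFluidPath p T x y where
  reflect : ∀ t ∈ Icc 0 T, x t 0 = y t - min (sInf (y '' Icc 0 t)) 0

namespace IsReflectedPath

variable {p : ℕ → ℝ} {T : ℝ} {x : ℝ → ℕ → ℝ} {y z : ℝ → ℝ} (hx : IsReflectedPath p T x y)
  (h : FiniteSecondMoment p) (hz1 : ∀ t ∈ Icc 0 T, z t ∈ Icc (0 : ℝ) 1)
  (hzx : ∀ t ∈ Icc 0 T, ∀ k, 1 ≤ k → x t k = p k * z t ^ k)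
  (hanti : AntitoneOn z (Icc 0 T)) {ρ : ℝ} (hρ : IsThreshold p ρ)

include hx h

theorem totalRate_eq {t : ℝ} (ht : t ∈ Icc 0 T) :
    totalRate (x t) = mean p - 2 * activeTime x 0 t - min (sInf (y '' Icc 0 t)) 0 := by
  rw [(hx.state t ht).totalRate_eq, hx.reflect t ht, hx.netflow_eq h ht]
  ring

/-- A priori bound: the reflection term only adds to the rate. It keeps the path active up to time
`μ / 2`. -/
theorem le_totalRate {t : ℝ} (ht : t ∈ Icc 0 T) : mean p - 2 * t ≤ totalRate (x t) := by
  rw [hx.totalRate_eq h ht]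
  linarith [hx.activeTime_le h hx.zero_mem ht ht.1, min_le_right (sInf (y '' Icc 0 t)) 0]

theorem activeTime_eq_self {t : ℝ} (ht : t ∈ Icc 0 T) (htm : 2 * t ≤ mean p) :
    activeTime x 0 t = t := by
  rw [IsStatePath.activeTime_eq ht.1, sub_zero]
  intro s hs
  have := hx.le_totalRate h ⟨hs.1.le, hs.2.le.trans ht.2⟩
  linarith [hs.2]

include hz1 hzx

theorem profile_sq_le {t : ℝ} (ht : t ∈ Icc 0 T) (htm : 2 * t < mean p) :
    1 - 2 * t / mean p ≤ z t ^ 2 := by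
  have hm := h.mean_pos
  have hsub : Icc 0 t ⊆ Icc 0 T := Icc_subset_Icc_right ht.2
  have hpos : ∀ s ∈ Icc 0 t, 0 < mean p - 2 * s := fun s hs => by linarith [hs.2]
  have hr : ∀ s ∈ Icc 0 t, 0 < totalRate (x s) := fun s hs =>
    (hpos s hs).trans_le (hx.le_totalRate h (hsub hs))
  rw [hx.eq_exp_of_pos h hz1 hzx ht hr, one_sub_div hm.ne', ← exp_neg_integral_inv_sq ht.1 htm]
  refine pow_le_pow_left₀ (Real.exp_pos _).le (Real.exp_le_exp.2 (neg_le_neg ?_)) 2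
  refine intervalIntegral.integral_mono_on ht.1 ?_ ?_ fun s hs =>
    inv_anti₀ (hpos s hs) (hx.le_totalRate h (hsub hs))
  · refine ContinuousOn.intervalIntegrable ?_
    rw [uIcc_of_le ht.1]
    exact ((hx.continuousOn_totalRate h).mono hsub).inv₀ fun s hs => (hr s hs).ne'
  · refine ContinuousOn.intervalIntegrable ?_
    rw [uIcc_of_le ht.1]
    exact ContinuousOn.inv₀ (by fun_prop) fun s hs => (hpos s hs).ne'

theorem sq_le_of_totalRate_le {c t : ℝ} (ht : t ∈ Icc 0 T) (htm : 2 * t < mean p)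
    (hc : ∀ s ∈ Icc 0 t, totalRate (x s) ≤ c - 2 * s) : z t ^ 2 ≤ (c - 2 * t) / c := by
  have hsub : Icc 0 t ⊆ Icc 0 T := Icc_subset_Icc_right ht.2
  have hr : ∀ s ∈ Icc 0 t, 0 < totalRate (x s) := fun s hs =>
    lt_of_lt_of_le (by linarith [hs.2]) (hx.le_totalRate h (hsub hs))
  have hct : 2 * t < c := by linarith [hr t ⟨ht.1, le_rfl⟩, hc t ⟨ht.1, le_rfl⟩]
  rw [hx.eq_exp_of_pos h hz1 hzx ht hr, ← exp_neg_integral_inv_sq ht.1 hct]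
  refine pow_le_pow_left₀ (Real.exp_pos _).le (Real.exp_le_exp.2 (neg_le_neg ?_)) 2
  refine intervalIntegral.integral_mono_on ht.1 ?_ ?_ fun s hs =>
    inv_anti₀ (hr s hs) (hc s hs)
  · refine ContinuousOn.intervalIntegrable ?_
    rw [uIcc_of_le ht.1]
    exact ContinuousOn.inv₀ (by fun_prop) fun s hs => by linarith [hr s hs, hc s hs]
  · refine ContinuousOn.intervalIntegrable ?_
    rw [uIcc_of_le ht.1]
    exact ((hx.continuousOn_totalRate h).mono hsub).inv₀ fun s hs => (hr s hs).ne'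

omit hz1 in
theorem netflow_eq_of_le {t : ℝ} (ht : t ∈ Icc 0 T) (htm : 2 * t ≤ mean p) :
    y t = mean p - 2 * t - edgeSeries p (z t) := by
  rw [hx.netflow_eq h ht, hx.activeTime_eq_self h ht htm,
    IsFluidPath.tsum_eq_edgeSeries hzx ht]

include hρ

theorem netflow_nonneg_of_lt {t : ℝ} (ht : t ∈ Icc 0 T) (htτ : t ≤ tau p ρ)
    (htm : 2 * t < mean p) : 0 ≤ y t := by
  by_contra! hneg
  have hm := h.mean_pos
  have hyc := (hx.continuousOn_netflow h).mono (Icc_subset_Icc_right ht.2)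
  obtain ⟨a, ha, hmin⟩ := isCompact_Icc.exists_isMinOn (nonempty_Icc.2 ht.1) hyc
  have haT : a ∈ Icc 0 T := ⟨ha.1, ha.2.trans ht.2⟩
  have ham : 2 * a < mean p := by linarith [ha.2]
  have hya : y a < 0 := lt_of_le_of_lt (hmin ⟨ht.1, le_rfl⟩) hneg
  have hrate : ∀ s ∈ Icc 0 a, totalRate (x s) ≤ (mean p - y a) - 2 * s := by
    intro s hs
    have hsT : s ∈ Icc 0 T := ⟨hs.1, hs.2.trans haT.2⟩
    rw [hx.totalRate_eq h hsT, hx.activeTime_eq_self h hsT (by linarith [hs.2])]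
    have : y a ≤ min (sInf (y '' Icc 0 s)) 0 := by
      refine le_min (le_csInf ((nonempty_Icc.2 hs.1).image y) ?_) hya.le
      rintro _ ⟨u, hu, rfl⟩
      exact hmin ⟨hu.1, hu.2.trans (hs.2.trans ha.2)⟩
    linarith
  have h1 := hx.sq_le_of_totalRate_le h hz1 hzx haT ham hrate
  have h2 := hx.profile_sq_le h hz1 hzx haT ham
  have h3 := hx.netflow_eq_of_le h hzx haT ham.le
  have hza : z a ∈ Icc ρ 1 := ⟨abs_le_of_sq_le_sq' ((IsThreshold.sq_le_of_le_tau h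
    (ha.2.trans htτ)).trans h2) (hz1 a haT).1 |>.2, (hz1 a haT).2⟩
  have h4 := hρ.edgeSeries_le _ hza
  rw [le_div_iff₀ (by linarith)] at h1
  -- With `c = μ - y a > μ`, `h1` and `h3` give `c z² ≤ c - 2a = edgeSeries p z`, which is at most
  -- `μ z²` by `h4`. Also `y a < 0` gives `μ - 2a < μ z²`, so `z² > 0`: a contradiction.
  nlinarith

theorem profile_sq_eq_of_lt {t : ℝ} (ht : t ∈ Icc 0 T) (htτ : t ≤ tau p ρ)
    (htm : 2 * t < mean p) : z t ^ 2 = 1 - 2 * t / mean p := by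
  refine le_antisymm ?_ (hx.profile_sq_le h hz1 hzx ht htm)
  rw [one_sub_div h.mean_pos.ne']
  refine hx.sq_le_of_totalRate_le h hz1 hzx ht htm fun s hs => ?_
  have hsT : s ∈ Icc 0 T := ⟨hs.1, hs.2.trans ht.2⟩
  rw [hx.totalRate_eq h hsT, hx.activeTime_eq_self h hsT (by linarith [hs.2]),
    min_sInf_eq_zero hs.1 fun u hu => ?_, sub_zero]
  exact hx.netflow_nonneg_of_lt h hz1 hzx hρ ⟨hu.1, hu.2.trans hsT.2⟩
    (hu.2.trans (hs.2.trans htτ)) (by linarith [hu.2, hs.2])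

include hanti

theorem profile_sq_eq {t : ℝ} (ht : t ∈ Icc 0 T) (htτ : t ≤ tau p ρ) :
    z t ^ 2 = 1 - 2 * t / mean p := by
  have hm := h.mean_pos
  have htm : 2 * t ≤ mean p := by linarith [IsThreshold.tau_le h (ρ := ρ)]
  rcases htm.lt_or_eq with hlt | heq
  · exact hx.profile_sq_eq_of_lt h hz1 hzx hρ ht htτ hlt
  rw [heq, div_self hm.ne', sub_self]
  -- At `t = μ / 2` the comparison integral diverges, so the value is reached by monotonicity from
  -- an earlier `s`, chosen so that `1 - 2 s / μ ≤ ε`.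
  refine le_antisymm (le_of_forall_pos_le_add fun ε hε => ?_) (sq_nonneg _)
  set s : ℝ := max 0 (t - mean p * ε / 2) with hs
  have hst : s < t := max_lt (by linarith) (by have := mul_pos hm hε; linarith)
  have hsT : s ∈ Icc 0 T := ⟨le_max_left _ _, hst.le.trans ht.2⟩
  have h1 := hx.profile_sq_eq_of_lt h hz1 hzx hρ hsT (hst.le.trans htτ) (by linarith)
  have h2 := pow_le_pow_left₀ (hz1 t ht).1 (hanti hsT ht hst.le) 2
  have h3 : t - mean p * ε / 2 ≤ s := le_max_right _ _
  have h4 : 1 - 2 * s / mean p ≤ ε := by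
    rw [one_sub_div hm.ne', div_le_iff₀ hm]
    linarith
  linarith

theorem netflow_eq_sq {t : ℝ} (ht : t ∈ Icc 0 T) (htτ : t ≤ tau p ρ) :
    y t = mean p * z t ^ 2 - edgeSeries p (z t) := by
  have hm := h.mean_pos.ne'
  have htm : 2 * t ≤ mean p := by linarith [IsThreshold.tau_le h (ρ := ρ)]
  rw [hx.netflow_eq_of_le h hzx ht htm, hx.profile_sq_eq h hz1 hzx hanti hρ ht htτ]
  field_simp

theorem mem_Icc_of_le_tau {t : ℝ} (ht : t ∈ Icc 0 T) (htτ : t ≤ tau p ρ) : z t ∈ Icc ρ 1 := by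
  refine ⟨abs_le_of_sq_le_sq' ?_ (hz1 t ht).1 |>.2, (hz1 t ht).2⟩
  rw [hx.profile_sq_eq h hz1 hzx hanti hρ ht htτ]
  exact IsThreshold.sq_le_of_le_tau h htτ

theorem netflow_nonneg {t : ℝ} (ht : t ∈ Icc 0 T) (htτ : t ≤ tau p ρ) : 0 ≤ y t := by
  rw [hx.netflow_eq_sq h hz1 hzx hanti hρ ht htτ]
  exact sub_nonneg.2 (hρ.edgeSeries_le _ (hx.mem_Icc_of_le_tau h hz1 hzx hanti hρ ht htτ))

theorem eq_profile_of_le {t : ℝ} (ht : t ∈ Icc 0 T) (htτ : t ≤ tau p ρ) :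
    z t = profile p ρ t := by
  rw [← abs_of_nonneg (hz1 t ht).1, ← abs_of_nonneg (hρ.profile_mem h ht.1).1, ← sq_eq_sq_iff_abs_eq_abs,
    hx.profile_sq_eq h hz1 hzx hanti hρ ht htτ, IsThreshold.profile_sq h htτ]

theorem zero_eq_of_le {t : ℝ} (ht : t ∈ Icc 0 T) (htτ : t ≤ tau p ρ) :
    x t 0 = mean p * z t ^ 2 - edgeSeries p (z t) := by
  rw [hx.reflect t ht, min_sInf_eq_zero ht.1 fun s hs => ?_, sub_zero,
    hx.netflow_eq_sq h hz1 hzx hanti hρ ht htτ]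
  exact hx.netflow_nonneg h hz1 hzx hanti hρ ⟨hs.1, hs.2.trans ht.2⟩ (hs.2.trans htτ)

theorem zero_eq_of_ge {t : ℝ} (ht : t ∈ Icc 0 T) (htτ : tau p ρ ≤ t) : x t 0 = 0 := by
  have hτT : tau p ρ ∈ Icc 0 T := ⟨hρ.tau_nonneg h, htτ.trans ht.2⟩
  have hzτ : z (tau p ρ) = ρ := by
    rw [hx.eq_profile_of_le h hz1 hzx hanti hρ hτT le_rfl, hρ.profile_tau h]
  rw [hx.reflect t ht, min_sInf_eq_of_antitoneOn (hρ.tau_nonneg h)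
    (fun s hs => hx.netflow_nonneg h hz1 hzx hanti hρ ⟨hs.1, hs.2.trans hτT.2⟩ hs.2) ?_
    (hx.antitoneOn_netflow h hz1 hzx hρ hanti hτT hzτ.le) ⟨htτ, ht.2⟩, sub_self]
  rw [hx.netflow_eq_sq h hz1 hzx hanti hρ hτT le_rfl, hzτ, hρ.edgeSeries_eq, sub_self]

theorem eq_profile {t : ℝ} (ht : t ∈ Icc 0 T) : z t = profile p ρ t := by
  rcases le_total t (tau p ρ) with htτ | htτ
  · exact hx.eq_profile_of_le h hz1 hzx hanti hρ ht htτ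
  have hτT : tau p ρ ∈ Icc 0 T := ⟨hρ.tau_nonneg h, htτ.trans ht.2⟩
  have hzτ : z (tau p ρ) = ρ := by
    rw [hx.eq_profile_of_le h hz1 hzx hanti hρ hτT le_rfl, hρ.profile_tau h]
  have h1 := hx.G₀_sub_eq h hz1 hzx hτT ht
  have h2 : ∫ s in (tau p ρ)..t, rate 0 (x s) = 0 := by
    refine (intervalIntegral.integral_congr fun s hs => ?_).trans
      intervalIntegral.integral_zero
    rw [uIcc_of_le htτ] at hs
    have hsT : s ∈ Icc 0 T := ⟨hτT.1.trans hs.1, hs.2.trans ht.2⟩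
    simp [rate, hx.zero_eq_of_ge h hz1 hzx hanti hρ hsT hs.1]
  rw [hzτ, h2, sub_zero] at h1
  have h3 := hx.activeTime_le h hτT ht htτ
  have h4 := h.strictMonoOn_G₀.monotoneOn (by simp) (hz1 t ht) (hz1 t ht).1
  rw [h.G₀_zero] at h4
  refine h.strictMonoOn_G₀.injOn (hz1 t ht) (hρ.profile_mem h ht.1) ?_
  rw [(hρ.profile_spec h htτ).2]
  -- If `z t > 0`, then `z > 0` on the whole of `[τ, t]`, so the active time is `t - τ`. If `z t =
  -- 0`, the active time equals `G₀(ρ)` and is at most `t - τ`, so the maximum is 0.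
  rcases (hz1 t ht).1.eq_or_lt with h0 | h0
  · rw [← h0, h.G₀_zero] at h1 ⊢
    rw [max_eq_right (by linarith)]
  · have h5 : activeTime x (tau p ρ) t = t - tau p ρ := by
      refine IsStatePath.activeTime_eq htτ fun s hs => ?_
      have hsT : s ∈ Icc 0 T := ⟨hτT.1.trans hs.1.le, hs.2.le.trans ht.2⟩
      obtain ⟨k, hk, hpk⟩ := h.exists_pos
      refine (hx.state s hsT).totalRate_pos h (k := k) ?_
      rw [hzx s hsT k hk]
      exact mul_pos hpk (pow_pos (h0.trans_le (hanti hsT ht hs.2.le)) k)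
    rw [max_eq_left (by linarith)]
    linarith

omit hz1 hzx hanti

theorem eq_zetaSup {t : ℝ} (ht : t ∈ Icc 0 T) : x t = zetaSup p ρ t := by
  obtain ⟨z, hanti, hz1, hzx⟩ := hx.exists_eq_mul_pow h
  have hz := hx.eq_profile h hz1 hzx hanti hρ ht
  funext k
  rcases Nat.eq_zero_or_pos k with rfl | hk
  · rcases le_total t (tau p ρ) with htτ | htτ
    · rw [hx.zero_eq_of_le h hz1 hzx hanti hρ ht htτ, IsThreshold.zetaSup_zero_of_le h htτ, hz]
    · rw [hx.zero_eq_of_ge h hz1 hzx hanti hρ ht htτ, hρ.zetaSup_zero_of_ge h htτ]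
  · rw [hzx t ht k hk, IsThreshold.zetaSup_eq h hk, hz]

end IsReflectedPath

/-! ### Existence -/

/-- Converts the `∑'` in `psiOf` into a genuine `HasSum`; summability comes from `∑ k pₖ` and the
finite active time. -/
theorem IsStatePath.hasSum_psiOf {p : ℕ → ℝ} {T : ℝ} {x : ℝ → ℕ → ℝ} (hx : IsStatePath p T x)
    (h : FiniteSecondMoment p)
    (heq : ∀ t ∈ Icc 0 T, ∀ k, 1 ≤ k → x t k = p k - ∫ s in (0 : ℝ)..t, rate k (x s))
    {t : ℝ} (ht : t ∈ Icc 0 T) :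
    HasSum (fun k : ℕ => ((k : ℝ) - 2) * ∫ s in (0 : ℝ)..t, rate k (x s)) (psiOf p x t) := by
  have h0 : (0 : ℝ) ∈ Icc 0 T := ⟨le_rfl, hx.nonneg⟩
  have h1 : Summable fun k : ℕ => if k = 0 then 0 else ((k : ℝ) - 2) * (p k - x t k) := by
    have h2 := (h.summable_mul.sub ((hx.state t ht).summable h)).sub
      ((((hx.hasSum_integral_rate h h0 ht).summable).sub
        (hasSum_ite_eq (0 : ℕ) (∫ s in (0 : ℝ)..t, rate 0 (x s))).summable).mul_left 2)
    refine h2.congr fun k => ?_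
    rcases Nat.eq_zero_or_pos k with rfl | hk
    · simp
    · rw [if_neg hk.ne', if_neg hk.ne', heq t ht k hk]
      ring
  refine ((hasSum_ite_eq (0 : ℕ) (-2 * ∫ s in (0 : ℝ)..t, rate 0 (x s))).add
    h1.hasSum).congr_fun fun k => ?_
  rcases Nat.eq_zero_or_pos k with rfl | hk
  · simp
  · rw [if_neg hk.ne', if_neg hk.ne', heq t ht k hk]
    ring

namespace IsThreshold

variable {p : ℕ → ℝ} {ρ : ℝ} (hρ : IsThreshold p ρ) (h : FiniteSecondMoment p)
include hρ h

theorem continuousOn_profile : ContinuousOn (profile p ρ) (Ici 0) := by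
  have h1 : ContinuousOn (profile p ρ) (Iic (tau p ρ)) := by
    have : Continuous fun t : ℝ => √(1 - 2 * t / mean p) := by fun_prop
    exact this.continuousOn.congr fun t ht => by rw [profile, if_pos (mem_Iic.1 ht)]
  have h2 : ContinuousOn (profile p ρ) (Ici (tau p ρ)) := by
    -- An injective continuous map on a compact interval is an embedding, so continuity of `G₀ ∘
    -- profile` gives that of `profile`.
    have hemb : IsClosedEmbedding ((Icc (0 : ℝ) 1).domRestrict (G₀ p)) :=
      h.continuousOn_G₀.domRestrict.isClosedEmbedding
        (injOn_iff_injective.1 h.strictMonoOn_G₀.injOn)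
    let φ : Ici (tau p ρ) → Icc (0 : ℝ) 1 := fun t =>
      ⟨profile p ρ t, hρ.profile_mem h ((hρ.tau_nonneg h).trans t.2)⟩
    have hφ : Continuous φ := by
      rw [hemb.isEmbedding.continuous_iff]
      have : Continuous fun t : Ici (tau p ρ) => max (G₀ p ρ - ((t : ℝ) - tau p ρ)) 0 := by
        fun_prop
      exact this.congr fun t => ((hρ.profile_spec h t.2).2).symm
    exact continuousOn_iff_continuous_domRestrict.2 (continuous_subtype_val.comp hφ)
  have h3 := h1.union_of_isClosed h2 isClosed_Iic isClosed_Ici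
  rw [Iic_union_Ici] at h3
  exact h3.mono (subset_univ _)

/-- The sign of `μ z² - edgeSeries p z` changes at `ρ`, so one formula serves before and after `τ`.
-/
theorem zetaSup_zero {t : ℝ} (h0 : 0 ≤ t) : zetaSup p ρ t 0 =
    max (mean p * profile p ρ t ^ 2 - edgeSeries p (profile p ρ t)) 0 := by
  rcases le_total t (tau p ρ) with ht | ht
  · rw [zetaSup_zero_of_le h ht, max_eq_left (sub_nonneg.2 (hρ.edgeSeries_le _
      (profile_mem_of_le h h0 ht)))]
  · rw [hρ.zetaSup_zero_of_ge h ht, max_eq_right (sub_nonpos.2 (hρ.le_edgeSeries _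
      (hρ.profile_spec h ht).1))]

theorem isStatePath_zetaSup {T : ℝ} (hT : 0 ≤ T) : IsStatePath p T (zetaSup p ρ) := by
  have hc : ContinuousOn (profile p ρ) (Icc 0 T) :=
    (hρ.continuousOn_profile h).mono Icc_subset_Ici_self
  refine ⟨hT, continuousOn_pi.2 fun k => ?_, fun t ht k => ?_⟩
  · rcases Nat.eq_zero_or_pos k with rfl | hk
    · refine ContinuousOn.congr (f := fun t => max (mean p * profile p ρ t ^ 2 -
        edgeSeries p (profile p ρ t)) 0) ?_ fun t ht => hρ.zetaSup_zero h ht.1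
      have : ContinuousOn (fun t => edgeSeries p (profile p ρ t)) (Icc 0 T) :=
        h.continuousOn_edgeSeries.comp hc fun t ht => hρ.profile_mem h ht.1
      fun_prop
    · exact ((hc.pow k).const_mul (p k)).congr fun t _ => zetaSup_eq h hk
  · have hz := hρ.profile_mem h ht.1
    rcases Nat.eq_zero_or_pos k with rfl | hk
    · rw [hρ.zetaSup_zero h ht.1]
      exact ⟨le_max_right _ _, by simp⟩
    · rw [zetaSup_eq h hk]
      exact ⟨mul_nonneg (h.nonneg k) (pow_nonneg hz.1 k),
        fun _ => mul_le_of_le_one_right (h.nonneg k) (pow_le_one₀ hz.1 hz.2)⟩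

theorem totalRate_zetaSup {t : ℝ} (h0 : 0 ≤ t) : totalRate (zetaSup p ρ t) =
    max (mean p * profile p ρ t ^ 2) (edgeSeries p (profile p ρ t)) := by
  have h1 : ∑' k : ℕ, (k : ℝ) * zetaSup p ρ t k = edgeSeries p (profile p ρ t) :=
    tsum_congr fun k => by
      rcases Nat.eq_zero_or_pos k with rfl | hk
      · simp
      · rw [zetaSup_eq h hk, mul_assoc]
  rw [((hρ.isStatePath_zetaSup h h0).state t ⟨h0, le_rfl⟩).totalRate_eq, h1,
    hρ.zetaSup_zero h h0, max_add, zero_add, sub_add_cancel]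

theorem totalRate_zetaSup_pos {t : ℝ} (h0 : 0 ≤ t) (hz : 0 < profile p ρ t) :
    0 < totalRate (zetaSup p ρ t) := by
  rw [hρ.totalRate_zetaSup h h0]
  exact lt_max_of_lt_left (mul_pos h.mean_pos (pow_pos hz 2))

omit hρ in
theorem profile_pos_of_lt {t : ℝ} (ht : t < tau p ρ) : 0 < profile p ρ t := by
  have hm := h.mean_pos
  rw [profile, if_pos ht.le, Real.sqrt_pos]
  refine (sq_nonneg ρ).trans_lt ?_
  rw [← one_sub_tau h]
  gcongr

theorem rate_zetaSup {t : ℝ} (h0 : 0 ≤ t) (hz : 0 < profile p ρ t) {k : ℕ} (hk : 1 ≤ k) :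
    rate k (zetaSup p ρ t) = p k * (k * profile p ρ t ^ (k - 1)) *
      (profile p ρ t / totalRate (zetaSup p ρ t)) := by
  rw [rate_of_pos (hρ.totalRate_zetaSup_pos h h0 hz) hk, zetaSup_eq h hk,
    ← pow_sub_one_mul (by omega : k ≠ 0) (profile p ρ t)]
  ring

theorem hasDerivAt_profile_of_lt {t : ℝ} (h0 : 0 ≤ t) (ht : t < tau p ρ) :
    HasDerivAt (profile p ρ) (-(profile p ρ t / totalRate (zetaSup p ρ t))) t := by
  have hm := h.mean_pos
  have hz := profile_pos_of_lt h ht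
  have hr : totalRate (zetaSup p ρ t) = mean p * profile p ρ t ^ 2 := by
    rw [hρ.totalRate_zetaSup h h0,
      max_eq_left (hρ.edgeSeries_le _ (profile_mem_of_le h h0 ht.le))]
  have h1 : HasDerivAt (fun s : ℝ => 1 - 2 * s / mean p) (-(2 / mean p)) t := by
    simpa using (((hasDerivAt_id t).const_mul 2).div_const (mean p)).const_sub 1
  have h2 := h1.sqrt (by rw [← profile_sq h ht.le]; positivity)
  have h3 : profile p ρ t = √(1 - 2 * t / mean p) := by rw [profile, if_pos ht.le]
  rw [← h3] at h2
  have h4 : HasDerivAt (profile p ρ) (-(2 / mean p) / (2 * profile p ρ t)) t := by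
    refine h2.congr_of_eventuallyEq ?_
    filter_upwards [Iio_mem_nhds ht] with s hs
    rw [profile, if_pos (mem_Iio.1 hs).le]
  convert! h4 using 1
  rw [hr]
  field_simp

theorem hasDerivAt_profile_of_gt {t : ℝ} (ht : tau p ρ < t) (ht' : t < tau p ρ + G₀ p ρ) :
    0 < profile p ρ t ∧
      HasDerivAt (profile p ρ) (-(profile p ρ t / totalRate (zetaSup p ρ t))) t := by
  have h0 : 0 ≤ t := (hρ.tau_nonneg h).trans ht.le
  have hG : ∀ s ∈ Ioo (tau p ρ) (tau p ρ + G₀ p ρ),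
      G₀ p (profile p ρ s) = G₀ p ρ - (s - tau p ρ) := fun s hs => by
    rw [(hρ.profile_spec h hs.1.le).2, max_eq_left (by linarith [hs.2])]
  have hmem := hρ.profile_mem h h0
  have hz : 0 < profile p ρ t := by
    refine lt_of_le_of_ne hmem.1 fun h1 => ?_
    have := hG t ⟨ht, ht'⟩
    rw [← h1, h.G₀_zero] at this
    linarith
  have hz1 : profile p ρ t < 1 := by
    refine lt_of_lt_of_le ((h.strictMonoOn_G₀.lt_iff_lt hmem hρ.mem).1 ?_) hρ.mem.2
    rw [hG t ⟨ht, ht'⟩]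
    linarith
  have hM := h.edgeSeries_pos hmem hz
  have hr : totalRate (zetaSup p ρ t) = edgeSeries p (profile p ρ t) := by
    rw [hρ.totalRate_zetaSup h h0,
      max_eq_right (hρ.le_edgeSeries _ (hρ.profile_spec h ht.le).1)]
  refine ⟨hz, ?_⟩
  have h1 : HasDerivAt (fun z => G₀ p ρ + tau p ρ - G₀ p z)
      (-(edgeSeries p (profile p ρ t) / profile p ρ t)) (profile p ρ t) :=
    (h.hasDerivAt_G₀ ⟨hz, hz1⟩).const_sub _
  -- Past `τ`, `profile` is a local inverse of `z ↦ G₀ p ρ + τ - G₀ p z`.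
  have h2 := h1.of_local_left_inverse (g := profile p ρ) (a := t)
    ((hρ.continuousOn_profile h).continuousAt (Ici_mem_nhds ((hρ.tau_nonneg h).trans_lt ht)))
    (neg_ne_zero.2 (div_pos hM hz).ne') (by
      filter_upwards [Ioo_mem_nhds ht ht'] with s hs
      rw [hG s hs]
      ring)
  convert! h2 using 1
  rw [hr, inv_neg, inv_div]

theorem profile_eq_zero {t : ℝ} (ht : tau p ρ + G₀ p ρ ≤ t) : profile p ρ t = 0 := by
  have hG := h.strictMonoOn_G₀.monotoneOn (by simp) hρ.mem hρ.mem.1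
  rw [h.G₀_zero] at hG
  have ht' : tau p ρ ≤ t := by linarith
  refine h.strictMonoOn_G₀.injOn (hρ.profile_mem h ((hρ.tau_nonneg h).trans ht')) (by simp) ?_
  rw [(hρ.profile_spec h ht').2, h.G₀_zero, max_eq_right (by linarith)]

theorem zetaSup_eq_integral {t : ℝ} (h0 : 0 ≤ t) {k : ℕ} (hk : 1 ≤ k) :
    zetaSup p ρ t k = p k - ∫ s in (0 : ℝ)..t, rate k (zetaSup p ρ s) := by
  have hx := hρ.isStatePath_zetaSup h h0
  -- The formula for `profile` changes at `τ` and at the extinction time `τ + G₀ p ρ`; these two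
  -- points are excluded.
  have h1 := integral_eq_of_hasDerivAt_off_countable_of_le
    (fun s => p k * profile p ρ s ^ k) (fun s => -rate k (zetaSup p ρ s)) h0
    (s := {tau p ρ, tau p ρ + G₀ p ρ}) (by simp)
    ((((hρ.continuousOn_profile h).mono Icc_subset_Ici_self).pow k).const_mul (p k)) ?_
    ((hx.intervalIntegrable_rate h k ⟨le_rfl, h0⟩ ⟨h0, le_rfl⟩).neg)
  · have h2 : profile p ρ 0 = 1 := by
      rw [profile, if_pos (hρ.tau_nonneg h)]
      simp
    simp only [intervalIntegral.integral_neg, h2, one_pow, mul_one] at h1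
    rw [zetaSup_eq h hk]
    linarith
  · rintro s ⟨hs, hsn⟩
    simp only [mem_insert_iff, mem_singleton_iff, not_or] at hsn
    have hs0 : 0 ≤ s := hs.1.le
    have key : 0 < profile p ρ s →
        HasDerivAt (profile p ρ) (-(profile p ρ s / totalRate (zetaSup p ρ s))) s →
        HasDerivAt (fun s => p k * profile p ρ s ^ k) (-rate k (zetaSup p ρ s)) s := by
      intro hz hd
      convert! (hd.pow k).const_mul (p k) using 1
      rw [hρ.rate_zetaSup h hs0 hz hk]
      ring
    rcases lt_or_gt_of_ne hsn.1 with hlt | hgt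
    · exact key (profile_pos_of_lt h hlt) (hρ.hasDerivAt_profile_of_lt h hs0 hlt)
    rcases lt_or_gt_of_ne hsn.2 with hlt | hgt'
    · obtain ⟨hz, hd⟩ := hρ.hasDerivAt_profile_of_gt h hgt hlt
      exact key hz hd
    · have hzero : (fun u => p k * profile p ρ u ^ k) =ᶠ[𝓝 s] fun _ => 0 := by
        filter_upwards [Ioi_mem_nhds hgt'] with u hu
        rw [hρ.profile_eq_zero h (mem_Ioi.1 hu).le, zero_pow (by omega), mul_zero]
      have hrate : rate k (zetaSup p ρ s) = 0 := by
        have : k ≠ 0 := by omega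
        rw [rate]
        simp [this, zetaSup_eq h hk, hρ.profile_eq_zero h hgt'.le]
      rw [hrate, neg_zero]
      exact (hasDerivAt_const s (0 : ℝ)).congr_of_eventuallyEq hzero

theorem isFluidPath_zetaSup {T : ℝ} (hT : 0 ≤ T) :
    IsFluidPath p T (zetaSup p ρ) (psiOf p (zetaSup p ρ)) where
  toIsStatePath := hρ.isStatePath_zetaSup h hT
  eq _ ht _ hk := hρ.zetaSup_eq_integral h ht.1 hk
  hasSum _ ht := (hρ.isStatePath_zetaSup h hT).hasSum_psiOf h
    (fun _ ht _ hk => hρ.zetaSup_eq_integral h ht.1 hk) ht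

theorem antitoneOn_profile {T : ℝ} (hT : 0 ≤ T) : AntitoneOn (profile p ρ) (Icc 0 T) := by
  intro s hs t ht hst
  obtain ⟨k, hk, hpk⟩ := h.exists_pos
  have h1 := (hρ.isFluidPath_zetaSup h hT).antitoneOn h hk hs ht hst
  simp only [zetaSup_eq h hk] at h1
  exact (pow_le_pow_iff_left₀ (hρ.profile_mem h ht.1).1 (hρ.profile_mem h hs.1).1
    (by omega)).1 (le_of_mul_le_mul_left h1 hpk)

theorem psiOf_zetaSup_of_le {t : ℝ} (h0 : 0 ≤ t) (ht : t ≤ tau p ρ) :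
    psiOf p (zetaSup p ρ) t = zetaSup p ρ t 0 := by
  have hx := hρ.isFluidPath_zetaSup h h0
  have hm := h.mean_pos.ne'
  rw [hx.netflow_eq h ⟨h0, le_rfl⟩, IsStatePath.activeTime_eq h0 fun s hs =>
    hρ.totalRate_zetaSup_pos h hs.1.le (profile_pos_of_lt h (hs.2.trans_le ht)),
    IsFluidPath.tsum_eq_edgeSeries (z := profile p ρ) (fun _ _ _ hk => zetaSup_eq h hk)
      (⟨h0, le_rfl⟩ : t ∈ Icc 0 t), zetaSup_zero_of_le h ht, profile_sq h ht]
  field_simp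
  ring

theorem isReflectedPath_zetaSup {T : ℝ} (hT : 0 ≤ T) :
    IsReflectedPath p T (zetaSup p ρ) (psiOf p (zetaSup p ρ)) where
  toIsFluidPath := hρ.isFluidPath_zetaSup h hT
  reflect t ht := by
    have hnn : ∀ s ∈ Icc 0 (tau p ρ), 0 ≤ psiOf p (zetaSup p ρ) s := fun s hs => by
      rw [hρ.psiOf_zetaSup_of_le h hs.1 hs.2, hρ.zetaSup_zero h hs.1]
      exact le_max_right _ _
    rcases le_total t (tau p ρ) with htτ | htτ
    · rw [min_sInf_eq_zero ht.1 fun s hs => hnn s ⟨hs.1, hs.2.trans htτ⟩, sub_zero,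
        hρ.psiOf_zetaSup_of_le h ht.1 htτ]
    · have hτT : tau p ρ ∈ Icc 0 T := ⟨hρ.tau_nonneg h, htτ.trans ht.2⟩
      rw [hρ.zetaSup_zero_of_ge h htτ, min_sInf_eq_of_antitoneOn hτT.1 hnn ?_
        ((hρ.isFluidPath_zetaSup h hT).antitoneOn_netflow h (fun _ ht => hρ.profile_mem h ht.1)
          (fun _ _ _ hk => zetaSup_eq h hk) hρ (hρ.antitoneOn_profile h hT) hτT
          (hρ.profile_tau h).le) ⟨htτ, ht.2⟩, sub_self]
      rw [hρ.psiOf_zetaSup_of_le h hτT.1 le_rfl, hρ.zetaSup_zero_of_ge h le_rfl]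

/-- The bound must survive `z → 0`. The total rate dominates both `edgeSeries p z` and `μ z²`: the
first absorbs the term `k = 1`, the second the terms `k ≥ 2`, where `z ^ k ≤ z²`. It makes `ψ`
Lipschitz. -/
theorem sum_mul_rate_zetaSup_le {t : ℝ} (h0 : 0 ≤ t) (u : Finset ℕ) :
    ∑ k ∈ u, (k : ℝ) * rate k (zetaSup p ρ t) ≤
      2 + (∑' k : ℕ, (k : ℝ) ^ 2 * p k) / mean p := by
  have hm := h.mean_pos
  have hS : 0 ≤ ∑' k : ℕ, (k : ℝ) ^ 2 * p k :=
    tsum_nonneg fun k => mul_nonneg (sq_nonneg _) (h.nonneg k)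
  by_cases hr : 0 < totalRate (zetaSup p ρ t)
  · set Z := profile p ρ t with hZ
    have hz : Z ∈ Icc (0 : ℝ) 1 := hρ.profile_mem h h0
    have hR := hρ.totalRate_zetaSup h h0
    have hM : edgeSeries p Z ≤ totalRate (zetaSup p ρ t) := hR ▸ le_max_right _ _
    have hQ : mean p * Z ^ 2 ≤ totalRate (zetaSup p ρ t) := hR ▸ le_max_left _ _
    have h1 : ∑ k ∈ u, (k : ℝ) * rate k (zetaSup p ρ t) * totalRate (zetaSup p ρ t) ≤
        2 * edgeSeries p Z + (∑' k : ℕ, (k : ℝ) ^ 2 * p k) * Z ^ 2 := by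
      have hs1 := (h.summable_edgeSeries hz).mul_left 2
      have hs2 := h.summable_sq.mul_right (Z ^ 2)
      rw [edgeSeries, ← tsum_mul_left, ← tsum_mul_right, ← hs1.tsum_add hs2]
      have hnn : ∀ k : ℕ, 0 ≤ 2 * ((k : ℝ) * p k * Z ^ k) + (k : ℝ) ^ 2 * p k * Z ^ 2 :=
        fun k => add_nonneg (mul_nonneg zero_le_two (mul_nonneg (h.mul_nonneg' k)
          (pow_nonneg hz.1 k))) (mul_nonneg (mul_nonneg (sq_nonneg _) (h.nonneg k)) (sq_nonneg _))
      refine le_trans (Finset.sum_le_sum fun k _ => ?_)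
        ((hs1.add hs2).sum_le_tsum u fun k _ => hnn k)
      rcases Nat.eq_zero_or_pos k with rfl | hk
      · simp
      rw [rate_of_pos hr hk, mul_assoc, div_mul_cancel₀ _ hr.ne', zetaSup_eq h hk]
      rcases k with _ | _ | k
      · simp
      · norm_num
        nlinarith [mul_nonneg (h.nonneg 1) hz.1, mul_nonneg (h.nonneg 1) (sq_nonneg Z)]
      · have h2 : Z ^ (k + 2) ≤ Z ^ 2 := pow_le_pow_of_le_one hz.1 hz.2 (by omega)
        have h3 := mul_le_mul_of_nonneg_left h2
          (mul_nonneg (sq_nonneg ((k + 1 + 1 : ℕ) : ℝ)) (h.nonneg (k + 1 + 1)))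
        have h4 : 0 ≤ ((k + 1 + 1 : ℕ) : ℝ) * p (k + 1 + 1) * Z ^ (k + 1 + 1) :=
          mul_nonneg (h.mul_nonneg' _) (pow_nonneg hz.1 _)
        calc _ = ((k + 1 + 1 : ℕ) : ℝ) ^ 2 * p (k + 1 + 1) * Z ^ (k + 2) := by ring
          _ ≤ _ := by linarith
    rw [← Finset.sum_mul] at h1
    refine le_of_mul_le_mul_right (h1.trans ?_) hr
    have h5 := mul_le_mul_of_nonneg_left hQ (div_nonneg hS hm.le)
    rw [← mul_assoc, div_mul_cancel₀ _ hm.ne'] at h5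
    linarith
  · have h1 : ∀ k : ℕ, (k : ℝ) * rate k (zetaSup p ρ t) = 0 := fun k => by simp [rate, hr]
    simp only [h1, Finset.sum_const_zero]
    positivity

theorem abs_psiOf_sub_le {T s t : ℝ} (hs : s ∈ Icc 0 T) (ht : t ∈ Icc 0 T) (hst : s ≤ t) :
    |psiOf p (zetaSup p ρ) t - psiOf p (zetaSup p ρ) s| ≤
      (4 + (∑' k : ℕ, (k : ℝ) ^ 2 * p k) / mean p) * (t - s) := by
  have hx := hρ.isFluidPath_zetaSup h (hs.1.trans hs.2)
  have h1 : HasSum (fun k : ℕ => (k : ℝ) * ∫ u in s..t, rate k (zetaSup p ρ u))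
      (∑' k : ℕ, (k : ℝ) * zetaSup p ρ s k - ∑' k : ℕ, (k : ℝ) * zetaSup p ρ t k) := by
    refine (((hx.state s hs).summable h).hasSum.sub
      ((hx.state t ht).summable h).hasSum).congr_fun fun k => ?_
    rcases Nat.eq_zero_or_pos k with rfl | hk
    · simp
    · rw [← hx.sub_eq h hs ht hk, mul_sub]
  have h2 := h1.nonneg fun k => mul_nonneg k.cast_nonneg (hx.integral_rate_nonneg hs ht hst k)
  have h3 : ∑' k : ℕ, (k : ℝ) * zetaSup p ρ s k - ∑' k : ℕ, (k : ℝ) * zetaSup p ρ t k ≤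
      (2 + (∑' k : ℕ, (k : ℝ) ^ 2 * p k) / mean p) * (t - s) := by
    refine hasSum_le_of_sum_le h1 fun u => ?_
    have hint : ∀ k ∈ u, IntervalIntegrable (fun v => (k : ℝ) * rate k (zetaSup p ρ v))
        volume s t := fun k _ => (hx.intervalIntegrable_rate h k hs ht).const_mul _
    simp_rw [← intervalIntegral.integral_const_mul]
    rw [← intervalIntegral.integral_finsetSum hint]
    have := intervalIntegral.integral_mono_on hst (IntervalIntegrable.sum u hint)
      (intervalIntegrable_const (c := 2 + (∑' k : ℕ, (k : ℝ) ^ 2 * p k) / mean p))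
      fun v hv => by
        rw [Finset.sum_apply]
        exact hρ.sum_mul_rate_zetaSup_le h (hs.1.trans hv.1) u
    rw [intervalIntegral.integral_const, smul_eq_mul, mul_comm] at this
    simpa only [Finset.sum_apply] using this
  have h4 := hx.activeTime_add h hx.zero_mem hs ht
  have h5 := hx.activeTime_le h hs ht hst
  have h6 : 0 ≤ activeTime (zetaSup p ρ) s t :=
    (hx.hasSum_integral_rate h hs ht).nonneg fun k => hx.integral_rate_nonneg hs ht hst k
  rw [hx.netflow_eq h hs, hx.netflow_eq h ht, abs_le]
  constructor <;> nlinarith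

end IsThreshold

/-! ### Zeros of the rate function -/

/-- Fenchel–Young inequality for `ell`, whose convex conjugate is `exp y - 1`. -/
theorem mul_le_ell_add_exp {x : ℝ} (hx : 0 ≤ x) (y : ℝ) :
    (x - 1) * y ≤ ell x + (Real.exp y - 1 - y) := by
  rw [ell]
  rcases hx.eq_or_lt with rfl | hx
  · have := Real.exp_pos y
    simp only [Real.log_zero]
    linarith
  · have h1 := Real.log_le_sub_one_of_pos (div_pos (Real.exp_pos y) hx)
    rw [Real.log_div (Real.exp_pos y).ne' hx.ne', Real.log_exp] at h1
    have h2 := mul_le_mul_of_nonneg_left h1 hx.le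
    rw [mul_sub, mul_sub, mul_div_cancel₀ _ hx.ne'] at h2
    linarith

/-- Take `y = ±ε` in the duality bound, where `exp y - 1 - y ≤ ε²`, and divide by `ε`. -/
theorem abs_sub_one_le_ell {x ε : ℝ} (hx : 0 ≤ x) (h0 : 0 < ε) (h1 : ε ≤ 1) :
    |x - 1| ≤ ε⁻¹ * ell x + ε := by
  have key : ε * |x - 1| ≤ ell x + ε ^ 2 := by
    rcases abs_cases (x - 1) with ⟨h2, -⟩ | ⟨h2, -⟩
    · have h3 := mul_le_ell_add_exp hx ε
      have h4 := Real.abs_exp_sub_one_sub_id_le (x := ε) (by rwa [abs_of_pos h0])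
      rw [h2]
      linarith [le_abs_self (Real.exp ε - 1 - ε)]
    · have h3 := mul_le_ell_add_exp hx (-ε)
      have h4 := Real.abs_exp_sub_one_sub_id_le (x := -ε) (by rwa [abs_neg, abs_of_pos h0])
      rw [h2]
      rw [neg_sq] at h4
      linarith [le_abs_self (Real.exp (-ε) - 1 - -ε)]
  have h2 := mul_le_mul_of_nonneg_left key (inv_nonneg.2 h0.le)
  rw [inv_mul_cancel_left₀ h0.ne', mul_add, sq, inv_mul_cancel_left₀ h0.ne'] at h2
  exact h2

theorem measurable_ell : Measurable ell := by
  unfold ell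
  fun_prop

/-! ### From admissible pairs on `[0, T]` to the fluid equations. -/

section ExtendPath

variable {T : ℝ} {E : Type*} [Zero E]

theorem extendPath_of_mem (f : Icc (0 : ℝ) T → E) {t : ℝ} (ht : t ∈ Icc 0 T) :
    extendPath f t = f ⟨t, ht⟩ := dif_pos ht

theorem extendPath_coe (f : Icc (0 : ℝ) T → E) (t : Icc (0 : ℝ) T) : extendPath f t = f t :=
  extendPath_of_mem f t.2

theorem continuousOn_extendPath [TopologicalSpace E] {f : Icc (0 : ℝ) T → E}
    (hf : Continuous f) : ContinuousOn (extendPath f) (Icc 0 T) := by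
  rw [continuousOn_iff_continuous_domRestrict]
  exact hf.congr fun t => (extendPath_coe f t).symm

end ExtendPath

theorem skorokhodMap_eq {T : ℝ} (ψ : Icc (0 : ℝ) T → ℝ) (t : Icc (0 : ℝ) T) :
    skorokhodMap ψ t = extendPath ψ t - min (sInf (extendPath ψ '' Icc 0 t)) 0 := by
  have : ψ '' Iic t = extendPath ψ '' Icc 0 t := by
    ext a
    constructor
    · rintro ⟨s, hs, rfl⟩
      exact ⟨s, ⟨s.2.1, hs⟩, extendPath_coe ψ s⟩
    · rintro ⟨s, hs, rfl⟩
      have hs' : s ∈ Icc 0 T := ⟨hs.1, hs.2.trans t.2.2⟩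
      exact ⟨⟨s, hs'⟩, hs.2, (extendPath_of_mem ψ hs').symm⟩
  rw [skorokhodMap, this, extendPath_coe]

theorem Admissible.isStatePath {p : ℕ → ℝ} {T : ℝ} (hT : 0 ≤ T) {ζ : Icc (0 : ℝ) T → ℕ → ℝ}
    {ψ : Icc (0 : ℝ) T → ℝ} (ha : Admissible p ζ ψ) : IsStatePath p T (extendPath ζ) := by
  obtain ⟨hζ, hψ, -, hr, hk⟩ := ha
  refine ⟨hT, continuousOn_extendPath hζ, fun t ht k => ?_⟩
  rw [extendPath_of_mem ζ ht]
  rcases Nat.eq_zero_or_pos k with rfl | hk'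
  · refine ⟨?_, by simp⟩
    rw [hr, skorokhodMap]
    have hb : BddBelow (ψ '' Iic ⟨t, ht⟩) :=
      (isCompact_range hψ).bddBelow.mono (image_subset_range _ _)
    have h1 := csInf_le hb ⟨⟨t, ht⟩, mem_Iic.2 le_rfl, rfl⟩
    linarith [min_le_left (sInf (ψ '' Iic ⟨t, ht⟩)) 0]
  · obtain ⟨h0, hanti, -, hnn⟩ := hk k hk'
    refine ⟨hnn _, fun _ => ?_⟩
    rw [← h0, extendPath_of_mem ζ (⟨le_rfl, hT⟩ : (0 : ℝ) ∈ Icc 0 T)]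
    exact hanti (Subtype.mk_le_mk.2 ht.1)

namespace IsStatePath

variable {p : ℕ → ℝ} {T : ℝ} {ζ : Icc (0 : ℝ) T → ℕ → ℝ}
  (hx : IsStatePath p T (extendPath ζ)) (h : FiniteSecondMoment p)
include hx h

theorem integrableOn_thinned_one (k : ℕ) :
    IntegrableOn (thinned ζ (fun _ _ => 1) k) (Icc (0 : ℝ) T ×ˢ Icc (0 : ℝ) 1) := by
  set r : ℝ → ℝ := fun s => rate k (extendPath ζ (projIcc 0 T hx.nonneg s)) with hr
  have hrm : Measurable r := hx.measurable_rate_proj h k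
  have hS : MeasurableSet {q : ℝ × ℝ | 0 ≤ q.2 ∧ q.2 < r q.1} :=
    (measurableSet_le measurable_const measurable_snd).inter
      (measurableSet_lt measurable_snd (hrm.comp measurable_fst))
  have h1 : IntegrableOn ({q : ℝ × ℝ | 0 ≤ q.2 ∧ q.2 < r q.1}.indicator fun _ => (1 : ℝ))
      (Icc (0 : ℝ) T ×ˢ Icc (0 : ℝ) 1) := by
    refine Measure.integrableOn_of_bounded (M := 1) ?_
      (measurable_const.indicator hS).aestronglyMeasurable (ae_of_all _ fun q => ?_)
    · rw [Measure.volume_eq_prod, Measure.prod_prod]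
      simp
    · refine (norm_indicator_le_norm_self _ _).trans ?_
      simp
  refine h1.congr_fun (fun q hq => ?_) (measurableSet_Icc.prod measurableSet_Icc)
  simp only [thinned, hr, indicator, mem_ofPred_eq, mem_Ico, hx.proj_eq hq.1, NNReal.coe_one]

theorem flux_one (k : ℕ) {t : ℝ} (ht : t ∈ Icc 0 T) :
    flux ζ (fun _ _ => 1) k t = ∫ s in (0 : ℝ)..t, rate k (extendPath ζ s) := by
  have h1 : IntegrableOn (thinned ζ (fun _ _ => 1) k) (Icc (0 : ℝ) t ×ˢ Icc (0 : ℝ) 1)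
      (volume.prod volume) := by
    rw [← Measure.volume_eq_prod]
    exact (hx.integrableOn_thinned_one h k).mono_set
      (prod_mono (Icc_subset_Icc_right ht.2) subset_rfl)
  rw [flux, Measure.volume_eq_prod, setIntegral_prod _ h1,
    intervalIntegral.integral_of_le ht.1, ← integral_Icc_eq_integral_Ioc]
  refine setIntegral_congr_fun measurableSet_Icc fun s hs => ?_
  have hst := hx.state s ⟨hs.1, hs.2.trans ht.2⟩
  have h0 := hst.rate_nonneg k
  have hle := hst.rate_le_one h k
  simp only [thinned, NNReal.coe_one]
  rw [integral_indicator measurableSet_Ico, Measure.restrict_restrict measurableSet_Ico,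
    inter_eq_left.2 (Ico_subset_Icc_self.trans (Icc_subset_Icc_right hle))]
  simp [h0]

end IsStatePath

/-- Thinning only decreases `|φ - 1|`; integrating the bound by `ell` gives `ε⁻¹ ε² + ε T`. -/
theorem abs_flux_sub_flux_one_le {p : ℕ → ℝ} {T : ℝ} {ζ : Icc (0 : ℝ) T → ℕ → ℝ}
    (hx : IsStatePath p T (extendPath ζ)) (h : FiniteSecondMoment p) {φ : ℕ → ℝ × ℝ → ℝ≥0}
    (hφ : ∀ k, Measurable (φ k))
    (hint : ∀ k, IntegrableOn (thinned ζ φ k) (Icc (0 : ℝ) T ×ˢ Icc (0 : ℝ) 1)) {ε : ℝ}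
    (h0 : 0 < ε) (h1 : ε ≤ 1) (hc : cost T φ ≤ ENNReal.ofReal (ε ^ 2)) (k : ℕ) {t : ℝ}
    (ht : t ∈ Icc 0 T) :
    |flux ζ φ k t - flux ζ (fun _ _ => 1) k t| ≤ ε * (1 + T) := by
  have hsub : Icc (0 : ℝ) t ×ˢ Icc (0 : ℝ) 1 ⊆ Icc (0 : ℝ) T ×ˢ Icc (0 : ℝ) 1 :=
    prod_mono (Icc_subset_Icc_right ht.2) subset_rfl
  rw [flux, flux, ← integral_sub ((hint k).mono_set hsub)
    ((hx.integrableOn_thinned_one h k).mono_set hsub), ← Real.norm_eq_abs, ← toReal_enorm]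
  refine ENNReal.toReal_le_of_le_ofReal (mul_nonneg h0.le (by linarith [hx.nonneg])) ?_
  have hvol : volume (Icc (0 : ℝ) T ×ˢ Icc (0 : ℝ) 1) = ENNReal.ofReal T := by
    rw [Measure.volume_eq_prod, Measure.prod_prod]
    simp
  calc ‖∫ q in Icc (0 : ℝ) t ×ˢ Icc (0 : ℝ) 1,
        thinned ζ φ k q - thinned ζ (fun _ _ => 1) k q‖ₑ
      ≤ ∫⁻ q in Icc (0 : ℝ) t ×ˢ Icc (0 : ℝ) 1,
        ‖thinned ζ φ k q - thinned ζ (fun _ _ => 1) k q‖ₑ := enorm_integral_le_lintegral_enorm _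
    _ ≤ ∫⁻ q in Icc (0 : ℝ) T ×ˢ Icc (0 : ℝ) 1,
        ‖thinned ζ φ k q - thinned ζ (fun _ _ => 1) k q‖ₑ := lintegral_mono_set hsub
    _ ≤ ∫⁻ q in Icc (0 : ℝ) T ×ˢ Icc (0 : ℝ) 1,
        (ENNReal.ofReal ε⁻¹ * ENNReal.ofReal (ell (φ k q)) + ENNReal.ofReal ε) := by
      refine lintegral_mono fun q => ?_
      have hb := abs_sub_one_le_ell (φ k q).2 h0 h1
      have hb' : |thinned ζ φ k q - thinned ζ (fun _ _ => 1) k q| ≤ |(φ k q : ℝ) - 1| := by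
        simp only [thinned, indicator]
        split_ifs
        · simp
        · simp
      rw [Real.enorm_eq_ofReal_abs, ← ENNReal.ofReal_mul (inv_nonneg.2 h0.le)]
      exact (ENNReal.ofReal_le_ofReal (hb'.trans hb)).trans ENNReal.ofReal_add_le
    _ = ENNReal.ofReal ε⁻¹ * (∫⁻ q in Icc (0 : ℝ) T ×ˢ Icc (0 : ℝ) 1,
        ENNReal.ofReal (ell (φ k q))) + ENNReal.ofReal ε * ENNReal.ofReal T := by
      rw [lintegral_add_right _ measurable_const, lintegral_const_mul, setLIntegral_const, hvol]
      exact (measurable_ell.comp (hφ k).coe_nnreal_real).ennreal_ofReal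
    _ ≤ ENNReal.ofReal ε⁻¹ * ENNReal.ofReal (ε ^ 2) + ENNReal.ofReal ε * ENNReal.ofReal T := by
      gcongr
      exact (ENNReal.le_tsum k).trans hc
    _ = ENNReal.ofReal (ε * (1 + T)) := by
      rw [← ENNReal.ofReal_mul (inv_nonneg.2 h0.le), ← ENNReal.ofReal_mul h0.le,
        ← ENNReal.ofReal_add (by positivity) (mul_nonneg h0.le hx.nonneg), sq,
        inv_mul_cancel_left₀ h0.ne', mul_add, mul_one]

theorem eq_of_forall_abs_sub_le {a b C : ℝ} (hC : 0 ≤ C)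
    (hab : ∀ ε, 0 < ε → ε ≤ 1 → |a - b| ≤ ε * C) : a = b := by
  refine eq_of_abs_sub_le_all fun δ hδ => ?_
  have hC' : 0 < C + 1 := by linarith
  refine (hab (min 1 (δ / (C + 1))) (lt_min one_pos (div_pos hδ hC')) (min_le_left _ _)).trans ?_
  calc _ ≤ δ / (C + 1) * C := mul_le_mul_of_nonneg_right (min_le_right _ _) hC
    _ ≤ δ / (C + 1) * (C + 1) := by
      have := (div_pos hδ hC').le
      gcongr
      linarith
    _ = δ := div_mul_cancel₀ _ hC'.ne'

theorem isReflectedPath_of_rateFunction_eq_zero {p : ℕ → ℝ} (h : FiniteSecondMoment p) {T : ℝ}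
    (hT : 0 ≤ T) {x : CadlagPath T (ℕ → ℝ) × CadlagPath T ℝ} (hx0 : rateFunction p T x = 0) :
    IsReflectedPath p T (extendPath x.1.1) (extendPath x.2.1) := by
  have ha : Admissible p x.1.1 x.2.1 := by
    by_contra hna
    rw [rateFunction, if_neg hna] at hx0
    exact ENNReal.top_ne_zero hx0
  rw [rateFunction, if_pos ha] at hx0
  have hx := ha.isStatePath hT
  have hex : ∀ ε : ℝ, 0 < ε → ε ≤ 1 → ∃ φ ∈ intensities p x.1.1 x.2.1,
      ∀ k, ∀ t ∈ Icc 0 T, |flux x.1.1 φ k t - ∫ s in (0 : ℝ)..t, rate k (extendPath x.1.1 s)| ≤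
        ε * (1 + T) := by
    intro ε h0 h1
    have hlt : ⨅ φ ∈ intensities p x.1.1 x.2.1, cost T φ < ENNReal.ofReal (ε ^ 2) := by
      rw [hx0]
      exact ENNReal.ofReal_pos.2 (by positivity)
    obtain ⟨φ, hlt⟩ := iInf_lt_iff.1 hlt
    obtain ⟨hφ, hlt⟩ := iInf_lt_iff.1 hlt
    refine ⟨φ, hφ, fun k t ht => ?_⟩
    rw [← hx.flux_one h k ht]
    exact abs_flux_sub_flux_one_le hx h hφ.1 hφ.2.1 h0 h1 hlt.le k ht
  have hT1 : 0 ≤ 1 + T := by linarith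
  have heq : ∀ t ∈ Icc 0 T, ∀ k, 1 ≤ k → extendPath x.1.1 t k =
      p k - ∫ s in (0 : ℝ)..t, rate k (extendPath x.1.1 s) := by
    intro t ht k hk
    refine eq_of_forall_abs_sub_le hT1 fun ε h0 h1 => ?_
    obtain ⟨φ, hφ, hfl⟩ := hex ε h0 h1
    rw [extendPath_of_mem x.1.1 ht, (hφ.2.2 ⟨t, ht⟩).2 k hk, sub_sub_sub_cancel_left, abs_sub_comm]
    exact hfl k t ht
  refine { hx with eq := heq, hasSum := fun t ht => ?_, reflect := fun t ht => ?_ }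
  · have hsum := hx.hasSum_psiOf h heq ht
    have hψ : psiOf p (extendPath x.1.1) t = extendPath x.2.1 t := by
      refine eq_of_forall_abs_sub_le (mul_nonneg zero_le_two hT1) fun ε h0 h1 => ?_
      obtain ⟨φ, hφ, hfl⟩ := hex ε h0 h1
      have h2 := hsum.sub (hφ.2.2 ⟨t, ht⟩).1
      -- For `k ≥ 1` the flux is determined by `ζ`, so these terms cancel exactly. Only `k = 0` can
      -- differ, with coefficient `-2`, whence the constant `2 (1 + T)`.
      have h3 := h2.unique (hasSum_single 0 fun k hk => by
        have h4 := (hφ.2.2 ⟨t, ht⟩).2 k (Nat.one_le_iff_ne_zero.2 hk)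
        have h5 := heq t ht k (Nat.one_le_iff_ne_zero.2 hk)
        rw [extendPath_of_mem x.1.1 ht] at h5
        rw [← mul_sub, show (∫ s in (0 : ℝ)..t, rate k (extendPath x.1.1 s)) -
          flux x.1.1 φ k t = 0 by simp only at h4; linarith, mul_zero])
      rw [extendPath_of_mem x.2.1 ht, h3, ← mul_sub, abs_mul]
      have h6 := hfl 0 t ht
      rw [abs_sub_comm] at h6
      norm_num
      linarith
    rw [← hψ]
    exact hsum
  · rw [extendPath_of_mem x.1.1 ht, ha.2.2.2.1, skorokhodMap_eq]

theorem ell_one : ell 1 = 0 := by simp [ell]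

theorem rateFunction_eq_zero {p : ℕ → ℝ} (h : FiniteSecondMoment p) {T : ℝ}
    {x : CadlagPath T (ℕ → ℝ) × CadlagPath T ℝ} (ha : Admissible p x.1.1 x.2.1)
    (hx : IsFluidPath p T (extendPath x.1.1) (extendPath x.2.1)) : rateFunction p T x = 0 := by
  rw [rateFunction, if_pos ha]
  refine le_antisymm (iInf₂_le_of_le (fun _ _ => 1) ⟨fun _ => measurable_const,
    fun k => hx.integrableOn_thinned_one h k, fun t => ⟨?_, fun k hk => ?_⟩⟩ ?_) zero_le
  · simp only [hx.flux_one h _ t.2]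
    rw [← extendPath_coe x.2.1 t]
    exact hx.hasSum t t.2
  · rw [hx.flux_one h _ t.2, ← extendPath_coe x.1.1 t]
    exact hx.eq t t.2 k hk
  · simp [cost, ell_one]

theorem IsReflectedPath.congr {p : ℕ → ℝ} {T : ℝ} {x x' : ℝ → ℕ → ℝ} {y y' : ℝ → ℝ}
    (hx : IsReflectedPath p T x y) (hxx : EqOn x' x (Icc 0 T)) (hyy : EqOn y' y (Icc 0 T)) :
    IsReflectedPath p T x' y' := by
  have hint : ∀ t ∈ Icc 0 T, ∀ k, ∫ s in (0 : ℝ)..t, rate k (x' s) =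
      ∫ s in (0 : ℝ)..t, rate k (x s) := fun t ht k => by
    refine intervalIntegral.integral_congr fun s hs => ?_
    rw [uIcc_of_le ht.1] at hs
    simp only [hxx ⟨hs.1, hs.2.trans ht.2⟩]
  refine ⟨⟨⟨hx.nonneg, hx.continuousOn.congr hxx, fun t ht => hxx ht ▸ hx.state t ht⟩,
    fun t ht k hk => ?_, fun t ht => ?_⟩, fun t ht => ?_⟩
  · rw [hxx ht, hint t ht, hx.eq t ht k hk]
  · simp only [hyy ht, hint t ht]
    exact hx.hasSum t ht
  · rw [hxx ht, hyy ht, hx.reflect t ht,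
      (hyy.mono (Icc_subset_Icc_right ht.2)).image_eq]

/-! ### The explicit pair is the unique zero. -/

theorem isCadlag_of_continuous {T : ℝ} {E : Type*} [TopologicalSpace E]
    {f : Icc (0 : ℝ) T → E} (hf : Continuous f) : IsCadlag f := fun t =>
  ⟨hf.continuousWithinAt, f t, (hf.tendsto t).mono_left nhdsWithin_le_nhds⟩

theorem absolutelyContinuousOnInterval_of_abs_sub_le {f : ℝ → ℝ} {T C : ℝ} (hT : 0 ≤ T)
    (hf : ∀ s ∈ Icc 0 T, ∀ t ∈ Icc 0 T, s ≤ t → |f t - f s| ≤ C * (t - s)) :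
    AbsolutelyContinuousOnInterval f 0 T := by
  have hC : LipschitzOnWith C.toNNReal f (uIcc 0 T) := by
    rw [uIcc_of_le hT]
    refine LipschitzOnWith.of_dist_le_mul fun s hs t ht => ?_
    have key : ∀ s ∈ Icc 0 T, ∀ t ∈ Icc 0 T, s ≤ t → |f t - f s| ≤ C.toNNReal * (t - s) :=
      fun s hs t ht hst => (hf s hs t ht hst).trans
        (mul_le_mul_of_nonneg_right (Real.le_coe_toNNReal C) (sub_nonneg.2 hst))
    rw [Real.dist_eq, Real.dist_eq]
    rcases le_total s t with hst | hst
    · rw [abs_sub_comm, abs_sub_comm s, abs_of_nonneg (sub_nonneg.2 hst)]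
      exact key s hs t ht hst
    · rw [abs_of_nonneg (sub_nonneg.2 hst)]
      exact key t ht s hs hst
  exact hC.absolutelyContinuousOnInterval

theorem IsFluidPath.abs_sub_le {p : ℕ → ℝ} {T : ℝ} {x : ℝ → ℕ → ℝ} {y : ℝ → ℝ}
    (hx : IsFluidPath p T x y) (h : FiniteSecondMoment p) {k : ℕ} (hk : 1 ≤ k) {s t : ℝ}
    (hs : s ∈ Icc 0 T) (ht : t ∈ Icc 0 T) (hst : s ≤ t) : |x t k - x s k| ≤ 1 * (t - s) := by
  rw [abs_sub_comm, hx.sub_eq h hs ht hk, abs_of_nonneg (hx.integral_rate_nonneg hs ht hst k)]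
  have := intervalIntegral.integral_mono_on hst (hx.intervalIntegrable_rate h k hs ht)
    (intervalIntegrable_const (c := (1 : ℝ)))
    fun u hu => (hx.state u ⟨hs.1.trans hu.1, hu.2.trans ht.2⟩).rate_le_one h k
  simpa using this

theorem IsThreshold.isUniqueZero {p : ℕ → ℝ} {ρ : ℝ} (hρ : IsThreshold p ρ)
    (h : FiniteSecondMoment p) {T : ℝ} (hT : 0 ≤ T) : IsUniqueZero p T (zetaSup p ρ) := by
  have hx := hρ.isReflectedPath_zetaSup h hT
  set ζ : Icc (0 : ℝ) T → ℕ → ℝ := fun t => zetaSup p ρ t with hζ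
  set ψ : Icc (0 : ℝ) T → ℝ := fun t => psiOf p (zetaSup p ρ) t with hψ
  have hζc : Continuous ζ := hx.continuousOn.domRestrict
  have hψc : Continuous ψ := (hx.continuousOn_netflow h).domRestrict
  have hζe : EqOn (extendPath ζ) (zetaSup p ρ) (Icc 0 T) := fun t ht => extendPath_of_mem ζ ht
  have hψe : EqOn (extendPath ψ) (psiOf p (zetaSup p ρ)) (Icc 0 T) :=
    fun t ht => extendPath_of_mem ψ ht
  have hx' : IsReflectedPath p T (extendPath ζ) (extendPath ψ) := hx.congr hζe hψe
  have hadm : Admissible p ζ ψ := by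
    refine ⟨hζc, hψc, ⟨hx'.netflow_zero h, ?_⟩, fun t => ?_, fun k hk =>
      ⟨hx'.initial hk, fun s t hst => hx.antitoneOn h hk s.2 t.2 hst, ?_,
        fun t => ((hx.state t t.2) k).1⟩⟩
    · refine absolutelyContinuousOnInterval_of_abs_sub_le
        (C := 4 + (∑' k : ℕ, (k : ℝ) ^ 2 * p k) / mean p) hT fun s hs t ht hst => ?_
      rw [hψe hs, hψe ht]
      exact hρ.abs_psiOf_sub_le h hs ht hst
    · rw [skorokhodMap_eq, ← hx'.reflect t t.2, extendPath_coe]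
    · exact absolutelyContinuousOnInterval_of_abs_sub_le hT
        fun s hs t ht hst => hx'.abs_sub_le h hk hs ht hst
  refine ⟨⟨⟨ζ, isCadlag_of_continuous hζc⟩, ⟨ψ, isCadlag_of_continuous hψc⟩⟩,
    fun t => ⟨rfl, rfl⟩, rateFunction_eq_zero h hadm hx'.toIsFluidPath, fun y hy => ?_⟩
  have hy' := isReflectedPath_of_rateFunction_eq_zero h hT hy
  have hyζ : ∀ t ∈ Icc 0 T, extendPath y.1.1 t = zetaSup p ρ t :=
    fun t ht => hy'.eq_zetaSup h hρ ht
  refine Prod.ext (Subtype.ext (funext fun t => ?_)) (Subtype.ext (funext fun t => ?_))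
  · rw [← extendPath_coe y.1.1 t, hyζ t t.2]
  -- `netflow_eq` expresses `ψ` through `ζ` alone, so equality of `ζ` suffices.
  · have h1 := hy'.netflow_eq h t.2
    have h2 := hx.netflow_eq h t.2
    have h3 : activeTime (extendPath y.1.1) 0 t = activeTime (zetaSup p ρ) 0 t := by
      refine intervalIntegral.integral_congr fun s hs => ?_
      rw [uIcc_of_le t.2.1] at hs
      simp only [hyζ s ⟨hs.1, hs.2.trans t.2.2⟩]
    rw [hyζ t t.2, h3, ← h2, extendPath_coe] at h1
    exact h1

theorem IsUniqueZero.congr {p : ℕ → ℝ} {T : ℝ} {ζ ζ' : ℝ → ℕ → ℝ} (hu : IsUniqueZero p T ζ)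
    (heq : EqOn ζ' ζ (Icc 0 T)) : IsUniqueZero p T ζ' := by
  obtain ⟨x, hx, h0, huniq⟩ := hu
  refine ⟨x, fun t => ⟨by rw [(hx t).1, heq t.2], ?_⟩, h0, huniq⟩
  rw [(hx t).2, psiOf, psiOf, heq t.2]
  congr 2
  refine intervalIntegral.integral_congr fun s hs => ?_
  rw [uIcc_of_le t.2.1] at hs
  simp only [heq ⟨hs.1, hs.2.trans t.2.2⟩]

/-- With `ρ = 1` one has `τ = 0`, so the first regime is the single time 0, where `fInv p 1 0 = 1`.
-/
theorem zetaSub_eq_zetaSup {p : ℕ → ℝ} (h : FiniteSecondMoment p) (hρ : IsThreshold p 1) {t : ℝ}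
    (ht : 0 ≤ t) : zetaSub p t = zetaSup p 1 t := by
  have hτ : tau p 1 = 0 := by simp [tau]
  have hprof : profile p 1 t = fInv p 1 t := by
    rcases ht.eq_or_lt with rfl | ht'
    · have h1 := hρ.profile_tau h
      obtain ⟨h2, h3⟩ := hρ.fInv_spec h one_pos (t := 0) ⟨le_rfl, by simp [h.G₀_one]⟩
      rw [hτ] at h1
      rw [one_mul, sub_zero] at h3
      rw [h1, h.strictMonoOn_G₀.injOn h2 (by simp) h3]
    · rw [profile, hτ, if_neg ht'.not_ge, one_mul, sub_zero]
  funext k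
  rcases Nat.eq_zero_or_pos k with rfl | hk
  · rw [hρ.zetaSup_zero_of_ge h (hτ.trans_le ht), zetaSub, if_pos rfl]
  · rw [IsThreshold.zetaSup_eq h hk, hprof, zetaSub, if_neg hk.ne']

end

end ConfigModel

theorem proposition3p2 (d : (n : ℕ) → Fin n → ℕ) (p : ℕ → ℝ)
    (hd : IsDegreeSequence d) (hlim : DegreeLimit d p) (hmom : SecondMomentBounded d)
    (T : ℝ) (hT : mean p / 2 ≤ T) :
    (criticality p ≤ 0 → IsUniqueZero p T (zetaSub p)) ∧
    (0 < criticality p →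
      (∃! ρ : ℝ, IsRoot p ρ) ∧ ∀ ρ : ℝ, IsRoot p ρ → IsUniqueZero p T (zetaSup p ρ)) := by
  have h := hlim.finiteSecondMoment hmom
  have hT0 : 0 ≤ T := by linarith [h.mean_pos]
  refine ⟨fun hc => ?_, fun hc => ⟨h.existsUnique_isRoot hc, fun ρ hρ =>
    (h.isThreshold_of_isRoot hc hρ).isUniqueZero h hT0⟩⟩
  have hρ := h.isThreshold_one hc
  exact (hρ.isUniqueZero h hT0).congr fun t ht => zetaSub_eq_zetaSup h hρ ht.1
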